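/- A partial automaton is a triple $\mathcal A=(Q,\Sigma,\delta)$ with finite $Q$, $\Sigma$ and a partial transition function $\delta:Q\times\Sigma\to Q$, extended to words as usual; it is complete if $\delta$ is total, strongly connected if for all $p,q\in Q$ some word maps $p$ to $q$, and synchronizing if $|\{\delta(q,w): q\in Q,\ \delta(q,w)\text{ defined}\}|=1$ for some word $w$. States $p,q$ are inseparable, $p\equiv q$, if for every word $u$, $\delta(p,u)$ is defined if and only if $\delta(q,u)$ is; $[q]$ denotes the class of $q$, and $\mathcal A/_\equiv$ the quotient automaton. A collecting tree of $\mathcal A$ is a tree $T$ on the set of classes, directed toward a root class $[r]$, whose edges are labeled by letters and are transitions of $\mathcal A/_\equiv$. The collecting automaton $\mathcal A^{\mathrm C(T)}=(Q,\Sigma\cup\{\gamma\},\delta^{\mathrm C(T)})$, with a fresh letter $\gamma$, is the complete automaton defined as follows. For $a\in\Sigma$, $\delta^{\mathrm C(T)}(q,a)=\delta(q,a)$ if this is defined, and $\delta^{\mathrm C(T)}(q,a)=q$ otherwise. Further, $\delta^{\mathrm C(T)}(q,\gamma)=q$ if $q\in[r]$, and otherwise $\delta^{\mathrm C(T)}(q,\gamma)=\delta(q,a)$,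 where $a$ is the label of the unique edge of $T$ leaving $[q]$. **Theorem.** There is an algorithm that, given a strongly connected partial automaton $\mathcal A$ with $n\ge 1$ states over an alphabet $\Sigma$ (as a transition table), constructs in $O(|\Sigma|\,n\log n)$ time a complete automaton (as a transition table), namely a collecting automaton $\mathcal A^{\mathrm C(T)}$ for some collecting tree $T$ of $\mathcal A$, that is synchronizing if and only if $\mathcal A$ is synchronizing. Here time is the number of steps of a unit-cost random access machine with words of $O(\log(|\Sigma|n+2))$ bits. The constants are absolute, and in the time bound the factors $|\Sigma|$ and $\log_2 n$ are read as $1$ when they are $0$, that is, when $\Sigma=\emptyset$ or $n=1$. -/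

import Mathlib

/-- A partial deterministic automaton without initial and final states, with states `Q` and input
alphabet `S`; `δ q a = none` means that the transition is undefined. -/
structure PartialAutomaton (Q S : Type*) where
  δ : Q → S → Option Q

namespace PartialAutomaton

/-- All transitions are defined. -/
def IsComplete {Q S : Type*} (A : PartialAutomaton Q S) : Prop :=
  ∀ q a, (A.δ q a).isSome

/-- The extension of the transition function to words. -/
def run {Q S : Type*} (A : PartialAutomaton Q S) : Q → List S → Option Q
  | q, [] => some q
  | q, a :: w => (A.δ q a).bind fun p => A.run p w

def StronglyConnected {Q S : Type*} (A : PartialAutomaton Q S) : Prop :=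
  ∀ p q, ∃ w, A.run p w = some q

/-- The image of a set `X` of states under the action of the word `w`. -/
def image {Q S : Type*} (A : PartialAutomaton Q S) (X : Set Q) (w : List S) : Set Q :=
  {p | ∃ q ∈ X, A.run q w = some p}

/-- The rank of a word (used for finite `Q` only). -/
noncomputable def rank {Q S : Type*} (A : PartialAutomaton Q S) (w : List S) : ℕ :=
  (A.image Set.univ w).ncard

/-- Some word has rank exactly one. -/
def Synchronizing {Q S : Type*} (A : PartialAutomaton Q S) : Prop :=
  ∃ w, A.rank w = 1

/-- Inseparability equivalence: the same words are defined at `p` and at `q`. -/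
def insep {Q S : Type*} (A : PartialAutomaton Q S) : Setoid Q where
  r p q := ∀ u, (A.run p u).isSome ↔ (A.run q u).isSome
  iseqv := ⟨fun _ _ => Iff.rfl, fun h u => (h u).symm, fun h h' u => (h u).trans (h' u)⟩

theorem insep_step {Q S : Type*} (A : PartialAutomaton Q S) (a : S) (p q : Q)
    (h : A.insep.r p q) :
    (A.δ p a).map (Quotient.mk A.insep) = (A.δ q a).map (Quotient.mk A.insep) := by
  have h1 := h [a]
  cases hp : A.δ p a with
  | none =>
    cases hq : A.δ q a with
    | none => rfl
    | some q' => simp [run, hp, hq] at h1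
  | some p' =>
    cases hq : A.δ q a with
    | none => simp [run, hp, hq] at h1
    | some q' =>
      simp only [Option.map_some, Option.some.injEq]
      apply Quotient.sound
      intro u
      have h2 := h (a :: u)
      simpa [run, hp, hq] using h2

/-- The set of inseparability classes. -/
abbrev Class {Q S : Type*} (A : PartialAutomaton Q S) : Type _ := Quotient A.insep

/-- The inseparability class of a state. -/
abbrev cls {Q S : Type*} (A : PartialAutomaton Q S) (q : Q) : A.Class := Quotient.mk A.insep q

/-- The quotient automaton by the inseparability equivalence. -/
def quot {Q S : Type*} (A : PartialAutomaton Q S) : PartialAutomaton A.Class S where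
  δ c a := Quotient.lift (fun q => (A.δ q a).map (Quotient.mk A.insep))
    (fun p q h => A.insep_step a p q h) c

/-- The fixing automaton: every undefined transition becomes a loop. -/
def fixing {Q S : Type*} (A : PartialAutomaton Q S) : PartialAutomaton Q S where
  δ q a := some ((A.δ q a).getD q)

/-- A collecting tree: a tree directed towards a root, whose vertices are the inseparability
classes and whose edges `(c, d, a)`, from `c` to `d` with label `a`, are transitions of the quotient
automaton. -/
structure CollectingTree {Q S : Type*} (A : PartialAutomaton Q S) where
  root : A.Class
  edges : Set (A.Class × A.Class × S)
  isTransition : ∀ c d a, (c, d, a) ∈ edges → A.quot.δ c a = some d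
  no_edge_from_root : ∀ d a, (root, d, a) ∉ edges
  existsUnique_edge : ∀ c, c ≠ root → ∃! e : A.Class × S, (c, e.1, e.2) ∈ edges
  reaches_root : ∀ c, Relation.ReflTransGen (fun c d => ∃ a, (c, d, a) ∈ edges) c root

open Classical in
/-- The collecting automaton of a collecting tree `T`, over the alphabet `S` with the fresh letter
`none` added. Old letters act as in the fixing automaton. The fresh letter is the identity on the
root class; on any other class it acts as the label of the only edge of `T` leaving this class. -/
noncomputable def collecting {Q S : Type*} (A : PartialAutomaton Q S) (T : A.CollectingTree) :
    PartialAutomaton Q (Option S) where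
  δ q x := match x with
    | some a => A.fixing.δ q a
    | none =>
      if h : A.cls q = T.root then some q
      else A.δ q (T.existsUnique_edge (A.cls q) h).choose.2

/-- Renaming of the letters. -/
def relabel {Q S S' : Type*} (A : PartialAutomaton Q S) (f : S' → S) : PartialAutomaton Q S' where
  δ q a := A.δ q (f a)

end PartialAutomaton

/-! ### Random access machine

A structured unit-cost word RAM. The memory consists of arrays of natural numbers, indexed by natural
numbers. A program names its arrays by literals, so it uses finitely many of them, while the indices
are computed (indirect addressing). Scalar registers are array cells with constant index. Every
number that occurs in a run (cell contents read, addresses, intermediate results) has to be below a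
word bound `W`; a computation that leaves this range has no run. -/
namespace RAM

abbrev Memory := ℕ → ℕ → ℕ

inductive Op
  | add | sub | mul | div | mod | lt | eq

/-- Subtraction is truncated, division is rounded down, `x / 0 = 0`, `x % 0 = x`; comparisons
yield `0` or `1`. -/
def Op.eval : Op → ℕ → ℕ → ℕ
  | .add, x, y => x + y
  | .sub, x, y => x - y
  | .mul, x, y => x * y
  | .div, x, y => x / y
  | .mod, x, y => x % y
  | .lt, x, y => if x < y then 1 else 0
  | .eq, x, y => if x = y then 1 else 0

inductive Expr
  | const (c : ℕ)
  | read (arr : ℕ) (i : Expr)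
  | op (o : Op) (x y : Expr)

def Expr.eval (M : Memory) : Expr → ℕ
  | .const c => c
  | .read arr i => M arr (i.eval M)
  | .op o x y => o.eval (x.eval M) (y.eval M)

/-- All values that occur in the evaluation are below `W`. -/
def Expr.Fits (W : ℕ) (M : Memory) : Expr → Prop
  | .const c => c < W
  | .read arr i => i.Fits W M ∧ M arr (i.eval M) < W
  | .op o x y => x.Fits W M ∧ y.Fits W M ∧ o.eval (x.eval M) (y.eval M) < W

/-- The number of elementary operations in the evaluation of an expression. -/
def Expr.cost : Expr → ℕ
  | .const _ => 1
  | .read _ i => i.cost + 1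
  | .op _ x y => x.cost + y.cost + 1

inductive Prog
  | skip
  /-- store the value of `e` in cell number `i` of the array `arr` -/
  | write (arr : ℕ) (i e : Expr)
  | seq (p q : Prog)
  /-- run `p` if the value of `e` is non-zero, and `q` otherwise -/
  | cond (e : Expr) (p q : Prog)
  /-- repeat `p` as long as the value of `e` is non-zero -/
  | loop (e : Expr) (p : Prog)

/-- `Exec W P M t M'`: on a machine with word bound `W`, the program `P`, started with memory `M`,
halts after exactly `t` steps with memory `M'`. -/
inductive Exec (W : ℕ) : Prog → Memory → ℕ → Memory → Prop
  | skip (M : Memory) : Exec W .skip M 1 M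
  | write (M : Memory) (arr : ℕ) (i e : Expr) (hi : i.Fits W M) (he : e.Fits W M) :
      Exec W (.write arr i e) M (i.cost + e.cost + 1)
        (Function.update M arr (Function.update (M arr) (i.eval M) (e.eval M)))
  | seq (p q : Prog) (M₁ M₂ M₃ : Memory) (t₁ t₂ : ℕ)
      (hp : Exec W p M₁ t₁ M₂) (hq : Exec W q M₂ t₂ M₃) :
      Exec W (.seq p q) M₁ (t₁ + t₂) M₃
  | cond_true (e : Expr) (p q : Prog) (M M' : Memory) (t : ℕ) (he : e.Fits W M)
      (h : e.eval M ≠ 0) (hp : Exec W p M t M') :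
      Exec W (.cond e p q) M (e.cost + 1 + t) M'
  | cond_false (e : Expr) (p q : Prog) (M M' : Memory) (t : ℕ) (he : e.Fits W M)
      (h : e.eval M = 0) (hq : Exec W q M t M') :
      Exec W (.cond e p q) M (e.cost + 1 + t) M'
  | loop_stop (e : Expr) (p : Prog) (M : Memory) (he : e.Fits W M) (h : e.eval M = 0) :
      Exec W (.loop e p) M (e.cost + 1) M
  | loop_step (e : Expr) (p : Prog) (M₁ M₂ M₃ : Memory) (t₁ t₂ : ℕ) (he : e.Fits W M₁)
      (h : e.eval M₁ ≠ 0) (hp : Exec W p M₁ t₁ M₂) (hl : Exec W (.loop e p) M₂ t₂ M₃) :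
      Exec W (.loop e p) M₁ (e.cost + 1 + t₁ + t₂) M₃

/-- A possibly undefined state as a number: `0` if undefined, and `q + 1` for the state `q`. -/
def code {n : ℕ} : Option (Fin n) → ℕ
  | none => 0
  | some q => q.val + 1

/-- The initial memory for the input `A`: array `0` holds `n` and `k`, array `1` holds the
transition table row by row, and everything else is zero. -/
def input {n k : ℕ} (A : PartialAutomaton (Fin n) (Fin k)) : Memory := fun arr i =>
  if arr = 0 then (if i = 0 then n else if i = 1 then k else 0)
  else if arr = 1 then
    (if h : i < n * k then
      code (A.δ ⟨i / k, Nat.div_lt_of_lt_mul (by rwa [Nat.mul_comm] at h)⟩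
        ⟨i % k, Nat.mod_lt _ (Nat.pos_of_ne_zero (by rintro rfl; simp at h))⟩)
    else 0)
  else 0

/-- The memory holds the automaton `B` as output: array `2` holds the numbers of states and letters,
array `3` holds the transition table row by row. -/
def IsOutput {n k : ℕ} (M : Memory) (B : PartialAutomaton (Fin n) (Fin k)) : Prop :=
  M 2 0 = n ∧ M 2 1 = k ∧ ∀ (q : Fin n) (a : Fin k), M 3 (q * k + a) = code (B.δ q a)

end RAM

/-!
The collecting automaton has the right synchronization behaviour for every collecting tree
(`PartialAutomaton.collecting_synchronizing_iff`). Powers of the fresh letter move all states into the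
root class, and since the states of a class admit the same words, a synchronizing word of the
partial automaton, preceded by a word that makes it applicable, then brings them together. Conversely,
every word of the collecting automaton acts on a single class as some word of the partial
automaton, and in the partial automaton some word has a nonempty image inside a single class.

So it remains to compute the inseparability classes and a collecting tree in time
`O(|Σ| n log n)`. The classes are computed by Hopcroft's partition refinement. The pairs of a
block `b` and a letter `a` are numbered by `b * k + a` and processed in this order by a counter `c`:
the blocks are split by the set of predecessors under `a` of the block `b`. When a block is split,
the smaller part gets a new number, which is larger than all numbers in use, so that all pairs with the
new block come after the counter, while those with the old block that have been processed stay
before it. Correctness (`IsRefining`) rests on the invariant that two states of a block whose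
successors under `a` lie in different blocks have a successor in a block whose pair with `a` is still
to be processed. This needs no more of the numbering than that new numbers are beyond the counter, so
the choice of the smaller part matters only for the running time (`potential_step_le`): each time
that a state and a letter are processed again, the block of the state has at most half the size.
The data structure (`IsPartition`) is a permutation of the states in which each block is a segment.
Marked elements are exchanged to the beginning of the segment of their block, so that the time for
splitting off the smaller part is bounded by the number of marked elements.

The tree is found by a backward search on the states from the state `0` (`IsSearch`): the
letter by which the search first enters a class labels the edge from this class.

For programs of the machine there is a calculus of preconditions (`RAM.WP`), in which running time
is part of the postcondition.
-/

/-! ### Preconditions for programs of the random access machine -/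

namespace RAM

/-- The memory `M` with the value `v` stored in cell `i` of the array `arr`. -/
def Memory.set (M : Memory) (arr i v : ℕ) : Memory :=
  Function.update M arr (Function.update (M arr) i v)

@[simp] theorem Memory.set_same (M : Memory) (arr i v : ℕ) :
    M.set arr i v arr = Function.update (M arr) i v := by
  simp [Memory.set]

@[simp] theorem Memory.set_of_ne (M : Memory) {arr arr' : ℕ} (i v : ℕ) (h : arr' ≠ arr) :
    M.set arr i v arr' = M arr' := by
  simp [Memory.set, h]

/-- `M'` differs from `M` only in the arrays in `l`. -/
def Frame (l : List ℕ) (M M' : Memory) : Prop := ∀ r ∉ l, M' r = M r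

theorem Frame.refl (l : List ℕ) (M : Memory) : Frame l M M := fun _ _ => rfl

theorem Frame.get {l : List ℕ} {M M' : Memory} (h : Frame l M M') (r : ℕ)
    (hr : r ∉ l := by decide) : M' r = M r := h r hr

theorem Frame.set {l : List ℕ} {M M' : Memory} (h : Frame l M M') {r i v : ℕ}
    (hr : r ∈ l := by decide) : Frame l M (M'.set r i v) := by
  intro s hs
  rw [Memory.set_of_ne _ _ _ (by rintro rfl; exact hs hr), h s hs]

theorem Frame.trans {l l' : List ℕ} {M M' M'' : Memory} (h : Frame l M M')
    (h' : Frame l' M' M'') (hl : l' ⊆ l := by decide) : Frame l M M'' :=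
  fun r hr => (h' r fun h => hr (hl h)).trans (h r hr)

namespace Expr

instance : Add Expr := ⟨.op .add⟩
instance : Sub Expr := ⟨.op .sub⟩
instance : Mul Expr := ⟨.op .mul⟩
instance : Div Expr := ⟨.op .div⟩
instance : Mod Expr := ⟨.op .mod⟩
instance : OfNat Expr 0 := ⟨.const 0⟩
instance : OfNat Expr 1 := ⟨.const 1⟩

/-- The comparison `x < y`, with value `0` or `1`. -/
abbrev lt (x y : Expr) : Expr := .op .lt x y

/-- The comparison `x = y`, with value `0` or `1`. -/
abbrev eq (x y : Expr) : Expr := .op .eq x y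

/-- The scalar variable held in cell `0` of the array `x`. -/
abbrev var (x : ℕ) : Expr := .read x 0

section eval
variable (M : Memory) (x y : Expr)
@[simp] theorem eval_add : (x + y).eval M = x.eval M + y.eval M := rfl
@[simp] theorem eval_sub : (x - y).eval M = x.eval M - y.eval M := rfl
@[simp] theorem eval_mul : (x * y).eval M = x.eval M * y.eval M := rfl
@[simp] theorem eval_div : (x / y).eval M = x.eval M / y.eval M := rfl
@[simp] theorem eval_mod : (x % y).eval M = x.eval M % y.eval M := rfl
@[simp] theorem eval_lt : (lt x y).eval M = if x.eval M < y.eval M then 1 else 0 := rfl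
@[simp] theorem eval_eq : (eq x y).eval M = if x.eval M = y.eval M then 1 else 0 := rfl
@[simp] theorem eval_read (r : ℕ) : (read r x).eval M = M r (x.eval M) := rfl
@[simp] theorem eval_zero : (0 : Expr).eval M = 0 := rfl
@[simp] theorem eval_one : (1 : Expr).eval M = 1 := rfl

variable (W : ℕ)
@[simp] theorem fits_add : (x + y).Fits W M ↔ x.Fits W M ∧ y.Fits W M ∧ x.eval M + y.eval M < W := Iff.rfl
@[simp] theorem fits_sub : (x - y).Fits W M ↔ x.Fits W M ∧ y.Fits W M ∧ x.eval M - y.eval M < W := Iff.rfl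
@[simp] theorem fits_mul : (x * y).Fits W M ↔ x.Fits W M ∧ y.Fits W M ∧ x.eval M * y.eval M < W := Iff.rfl
@[simp] theorem fits_div : (x / y).Fits W M ↔ x.Fits W M ∧ y.Fits W M ∧ x.eval M / y.eval M < W := Iff.rfl
@[simp] theorem fits_mod : (x % y).Fits W M ↔ x.Fits W M ∧ y.Fits W M ∧ x.eval M % y.eval M < W := Iff.rfl
@[simp] theorem fits_lt : (lt x y).Fits W M ↔
    x.Fits W M ∧ y.Fits W M ∧ (if x.eval M < y.eval M then 1 else 0) < W := Iff.rfl
@[simp] theorem fits_eq : (eq x y).Fits W M ↔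
    x.Fits W M ∧ y.Fits W M ∧ (if x.eval M = y.eval M then 1 else 0) < W := Iff.rfl
@[simp] theorem fits_read (r : ℕ) : (read r x).Fits W M ↔ x.Fits W M ∧ M r (x.eval M) < W := Iff.rfl
@[simp] theorem fits_zero : (0 : Expr).Fits W M ↔ 0 < W := Iff.rfl
@[simp] theorem fits_one : (1 : Expr).Fits W M ↔ 1 < W := Iff.rfl
end eval

section cost
variable (x y : Expr)
@[simp] theorem cost_add : (x + y).cost = x.cost + y.cost + 1 := rfl
@[simp] theorem cost_sub : (x - y).cost = x.cost + y.cost + 1 := rfl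
@[simp] theorem cost_mul : (x * y).cost = x.cost + y.cost + 1 := rfl
@[simp] theorem cost_div : (x / y).cost = x.cost + y.cost + 1 := rfl
@[simp] theorem cost_mod : (x % y).cost = x.cost + y.cost + 1 := rfl
@[simp] theorem cost_lt : (lt x y).cost = x.cost + y.cost + 1 := rfl
@[simp] theorem cost_eq : (eq x y).cost = x.cost + y.cost + 1 := rfl
@[simp] theorem cost_read (r : ℕ) : (read r x).cost = x.cost + 1 := rfl
@[simp] theorem cost_zero : (0 : Expr).cost = 1 := rfl
@[simp] theorem cost_one : (1 : Expr).cost = 1 := rfl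
end cost

end Expr

infixr:60 " ;; " => Prog.seq

/-- Total correctness: started with memory `M`, the program `P` halts after some number `t` of
steps with some memory `M'` such that `Q t M'`. -/
def WP (W : ℕ) (P : Prog) (M : Memory) (Q : ℕ → Memory → Prop) : Prop :=
  ∃ t M', Exec W P M t M' ∧ Q t M'

section WP
variable {W : ℕ} {M : Memory} {Q : ℕ → Memory → Prop}

theorem WP.mono {P : Prog} {Q' : ℕ → Memory → Prop} (h : WP W P M Q')
    (hQ : ∀ t M', Q' t M' → Q t M') : WP W P M Q := by
  obtain ⟨t, M', h1, h2⟩ := h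
  exact ⟨t, M', h1, hQ _ _ h2⟩

theorem wp_skip : WP W .skip M Q ↔ Q 1 M := by
  constructor
  · rintro ⟨t, M', h1, h2⟩
    cases h1
    exact h2
  · exact fun h => ⟨_, _, .skip M, h⟩

theorem wp_write {arr : ℕ} {i e : Expr} : WP W (.write arr i e) M Q ↔
    i.Fits W M ∧ e.Fits W M ∧ Q (i.cost + e.cost + 1) (M.set arr (i.eval M) (e.eval M)) := by
  constructor
  · rintro ⟨t, M', h1, h2⟩
    cases h1 with
    | write _ _ _ _ hi he => exact ⟨hi, he, h2⟩
  · exact fun h => ⟨_, _, .write M arr i e h.1 h.2.1, h.2.2⟩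

theorem wp_seq {p q : Prog} : WP W (p ;; q) M Q ↔
    WP W p M fun t M' => WP W q M' fun t' M'' => Q (t + t') M'' := by
  constructor
  · rintro ⟨t, M', h1, h2⟩
    cases h1 with
    | seq _ _ _ M₂ _ t₁ t₂ hp hq => exact ⟨t₁, M₂, hp, t₂, M', hq, h2⟩
  · rintro ⟨t, M', h1, t', M'', h2, h3⟩
    exact ⟨_, _, .seq _ _ _ _ _ _ _ h1 h2, h3⟩

theorem wp_cond {e : Expr} {p q : Prog} : WP W (.cond e p q) M Q ↔
    e.Fits W M ∧ (e.eval M ≠ 0 → WP W p M fun t M' => Q (e.cost + 1 + t) M') ∧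
      (e.eval M = 0 → WP W q M fun t M' => Q (e.cost + 1 + t) M') := by
  constructor
  · rintro ⟨t, M', h1, h2⟩
    cases h1 with
    | cond_true _ _ _ _ _ _ he h hp =>
      exact ⟨he, fun _ => ⟨_, _, hp, h2⟩, fun h' => absurd h' h⟩
    | cond_false _ _ _ _ _ _ he h hp =>
      exact ⟨he, fun h' => absurd h h', fun _ => ⟨_, _, hp, h2⟩⟩
  · rintro ⟨he, h1, h2⟩
    by_cases h : e.eval M = 0
    · obtain ⟨t, M', h3, h4⟩ := h2 h
      exact ⟨_, _, .cond_false _ _ _ _ _ _ he h h3, h4⟩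
    · obtain ⟨t, M', h3, h4⟩ := h1 h
      exact ⟨_, _, .cond_true _ _ _ _ _ _ he h h3, h4⟩

/-- Rule for loops: `Inv t M` is the invariant, where `t` is the time spent in the loop so far, and
the measure `μ` decreases. -/
theorem wp_loop {e : Expr} {p : Prog} (Inv : ℕ → Memory → Prop) (μ : Memory → ℕ)
    (init : Inv 0 M) (fits : ∀ t M, Inv t M → e.Fits W M)
    (step : ∀ t M, Inv t M → e.eval M ≠ 0 →
      WP W p M fun t' M' => Inv (t + (e.cost + 1 + t')) M' ∧ μ M' < μ M)
    (final : ∀ t M, Inv t M → e.eval M = 0 → Q (t + (e.cost + 1)) M) :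
    WP W (.loop e p) M Q := by
  suffices H : ∀ N t M, Inv t M → μ M < N → WP W (.loop e p) M fun t' M' => Q (t + t') M' by
    simpa using H _ 0 M init (Nat.lt_succ_self _)
  intro N
  induction N with
  | zero => intro t M _ h; omega
  | succ N ih =>
    intro t M hI hN
    by_cases h : e.eval M = 0
    · exact ⟨_, _, Exec.loop_stop _ _ _ (fits t M hI) h, final t M hI h⟩
    · obtain ⟨t', M', h1, h2, h3⟩ := step t M hI h
      obtain ⟨t'', M'', h4, h5⟩ := ih _ _ h2 (by omega)
      refine ⟨_, _, .loop_step _ _ _ _ _ _ _ (fits t M hI) h h1 h4, ?_⟩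
      convert h5 using 1
      omega

/-- Rule for loops with exactly `N` rounds. The invariant `Inv i t M` refers to the number `i` of
completed rounds and to the time `t` spent in the loop so far. -/
theorem wp_loop_count {e : Expr} {p : Prog} (N : ℕ) (Inv : ℕ → ℕ → Memory → Prop)
    (init : Inv 0 0 M) (fits : ∀ i t M, i ≤ N → Inv i t M → e.Fits W M)
    (test : ∀ i t M, i ≤ N → Inv i t M → (e.eval M ≠ 0 ↔ i < N))
    (step : ∀ i t M, i < N → Inv i t M →
      WP W p M fun t' M' => Inv (i + 1) (t + (e.cost + 1 + t')) M')
    (final : ∀ t M, Inv N t M → Q (t + (e.cost + 1)) M) :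
    WP W (.loop e p) M Q := by
  suffices H : ∀ d i t M, i + d = N → Inv i t M →
      WP W (.loop e p) M fun t' M' => Q (t + t') M' by
    simpa using H N 0 0 M (by omega) init
  intro d
  induction d with
  | zero =>
    intro i t M hi hI
    obtain rfl : i = N := by omega
    refine ⟨_, _, Exec.loop_stop _ _ _ (fits _ t M le_rfl hI) ?_, final t M hI⟩
    by_contra h
    exact lt_irrefl _ ((test _ _ _ le_rfl hI).1 h)
  | succ d ih =>
    intro i t M hi hI
    obtain ⟨t', M', h1, h2⟩ := step i t M (by omega) hI
    obtain ⟨t'', M'', h4, h5⟩ := ih _ _ _ (by omega) h2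
    refine ⟨_, _, .loop_step _ _ _ _ _ _ _ (fits _ t M (by omega) hI)
      ((test _ _ _ (by omega) hI).2 (by omega)) h1 h4, ?_⟩
    convert h5 using 1
    omega

-- This keeps anonymous constructors from unfolding `WP`.
attribute [irreducible] WP

end WP

end RAM

/-! ### Synchronization of collecting automata -/

namespace PartialAutomaton

variable {Q S : Type*} (A : PartialAutomaton Q S)

theorem run_append (q : Q) (u v : List S) :
    A.run q (u ++ v) = (A.run q u).bind fun p => A.run p v := by
  induction u generalizing q with
  | nil => simp [run]
  | cons a u ih =>
    simp only [List.cons_append, run, ih]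
    cases A.δ q a <;> simp

theorem image_append (X : Set Q) (u v : List S) :
    A.image X (u ++ v) = A.image (A.image X u) v := by
  ext p
  simp only [image, run_append, Set.mem_ofPred_eq, Option.bind_eq_some_iff]
  constructor
  · rintro ⟨q, hq, r, h1, h2⟩
    exact ⟨r, ⟨q, hq, h1⟩, h2⟩
  · rintro ⟨r, ⟨q, hq, h1⟩, h2⟩
    exact ⟨q, hq, r, h1, h2⟩

theorem synchronizing_iff : A.Synchronizing ↔ ∃ w p, A.image Set.univ w = {p} := by
  simp [Synchronizing, rank, Set.ncard_eq_one]

theorem insep_run {p q : Q} (h : A.insep.r p q) (w : List S) :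
    (A.run p w).map A.cls = (A.run q w).map A.cls := by
  induction w generalizing p q with
  | nil =>
    simp only [run, Option.map_some, Option.some.injEq]
    exact Quotient.sound h
  | cons a w ih =>
    have := A.insep_step a p q h
    cases hp : A.δ p a <;> cases hq : A.δ q a <;> simp only [hp, hq, Option.map_none,
      Option.map_some, reduceCtorEq, Option.some.injEq] at this
    · simp [run, hp, hq]
    · simp only [run, hp, hq, Option.bind_some]
      exact ih (Quotient.exact this)

/-- An equivalence that is respected by all transitions, including their being undefined, is
contained in inseparability. -/
theorem insep_of_congruence {α : Type*} (f : Q → α)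
    (h : ∀ p q, f p = f q → ∀ a, (A.δ p a).map f = (A.δ q a).map f) {p q : Q} (hpq : f p = f q) :
    A.insep.r p q := by
  intro u
  induction u generalizing p q with
  | nil => simp [run]
  | cons a u ih =>
    have := h p q hpq a
    cases hp : A.δ p a <;> cases hq : A.δ q a <;> simp only [hp, hq, Option.map_none,
      Option.map_some, reduceCtorEq, Option.some.injEq] at this
    · simp [run, hp, hq]
    · simp only [run, hp, hq, Option.bind_some]
      exact ih this

/-- Some word has a nonempty image inside a single inseparability class: as long as the image
contains two separable states, a separating word makes it smaller without emptying it. -/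
theorem exists_image_subset_class [Finite Q] [Nonempty Q] :
    ∃ w, (A.image Set.univ w).Nonempty ∧
      ∀ p ∈ A.image Set.univ w, ∀ q ∈ A.image Set.univ w, A.insep.r p q := by
  have key : ∀ N w, (A.image Set.univ w).Nonempty → (A.image Set.univ w).ncard ≤ N →
      ∃ w, (A.image Set.univ w).Nonempty ∧
        ∀ p ∈ A.image Set.univ w, ∀ q ∈ A.image Set.univ w, A.insep.r p q := by
    intro N
    induction N with
    | zero =>
      intro w hw hN
      rw [Nat.le_zero, Set.ncard_eq_zero (Set.toFinite _)] at hN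
      exact absurd hN hw.ne_empty
    | succ N ih =>
      intro w hw hN
      by_contra hcon
      have hsep : ∃ p ∈ A.image Set.univ w, ∃ q ∈ A.image Set.univ w, ∃ u,
          (A.run p u).isSome ∧ A.run q u = none := by
        by_contra h
        push Not at h
        refine hcon ⟨w, hw, fun p hp q hq u => ⟨fun h1 => ?_, fun h1 => ?_⟩⟩
        · exact Option.isSome_iff_ne_none.2 (h p hp q hq u h1)
        · exact Option.isSome_iff_ne_none.2 (h q hq p hp u h1)
      obtain ⟨p, hp, q, hq, u, h1, h2⟩ := hsep
      refine hcon (ih (w ++ u) ?_ ?_)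
      · obtain ⟨r, hr⟩ := Option.isSome_iff_exists.1 h1
        rw [image_append]
        exact ⟨r, p, hp, hr⟩
      · have hsub : A.image Set.univ (w ++ u) ⊆
            (fun s => (A.run s u).getD p) '' (A.image Set.univ w \ {q}) := by
          rw [image_append]
          rintro r ⟨s, hs, hr⟩
          refine ⟨s, ⟨hs, ?_⟩, by simp [hr]⟩
          rintro rfl
          simp [h2] at hr
        have := (Set.ncard_le_ncard hsub (Set.toFinite _)).trans (Set.ncard_image_le (Set.toFinite _))
        rw [Set.ncard_sdiff_singleton_of_mem hq] at this
        omega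
  exact key _ [] ⟨Classical.arbitrary Q, _, Set.mem_univ _, rfl⟩ le_rfl

section collecting

variable (T : A.CollectingTree)

theorem collecting_isComplete : (A.collecting T).IsComplete := by
  intro q x
  cases x with
  | some a => simp [collecting, fixing]
  | none =>
    simp only [collecting]
    split_ifs with h
    · rfl
    · have h1 := T.isTransition _ _ _ (T.existsUnique_edge (A.cls q) h).choose_spec.1
      simp only [quot, Quotient.lift_mk, Option.map_eq_some_iff] at h1
      obtain ⟨p, hp, -⟩ := h1
      exact Option.isSome_iff_exists.2 ⟨p, hp⟩

/-- The fresh letter moves every state of a class other than the root class along the edge of the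
tree that leaves this class. -/
theorem collecting_none {q : Q} {d : A.Class} {a : S} (h : (A.cls q, d, a) ∈ T.edges) :
    (A.collecting T).δ q none = A.δ q a := by
  have hne : A.cls q ≠ T.root := fun h' => T.no_edge_from_root d a (h' ▸ h)
  simp only [collecting, hne, dite_false]
  have := (T.existsUnique_edge (A.cls q) hne).choose_spec.2 (d, a) h
  rw [← this]

theorem collecting_none_root {q : Q} (h : A.cls q = T.root) :
    (A.collecting T).δ q none = some q := by
  simp [collecting, h]

/-- A letter of the collecting automaton acts on an inseparability class as a word of the original
automaton. -/
theorem collecting_letter_eq_run (p : Q) (x : Option S) :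
    ∃ u, (A.run p u).isSome ∧ ∀ q, A.insep.r p q → (A.collecting T).δ q x = A.run q u := by
  have hsome : ∀ (q : Q) (a : S), A.run q [a] = A.δ q a := by simp [run]
  cases x with
  | some a =>
    by_cases hp : (A.δ p a).isSome
    · refine ⟨[a], by rwa [hsome], fun q hq => ?_⟩
      have hq' := (hq [a]).1 (by rwa [hsome])
      rw [hsome] at hq' ⊢
      obtain ⟨r, hr⟩ := Option.isSome_iff_exists.1 hq'
      simp [collecting, fixing, hr]
    · refine ⟨[], rfl, fun q hq => ?_⟩
      have hq' := mt (hq [a]).2 (by rwa [hsome])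
      rw [hsome] at hq'
      simp only [Bool.not_eq_true, Option.isSome_eq_false_iff, Option.isNone_iff_eq_none] at hq'
      simp [collecting, fixing, hq', run]
  | none =>
    by_cases h : A.cls p = T.root
    · refine ⟨[], rfl, fun q hq => ?_⟩
      have : A.cls q = A.cls p := (Quotient.sound hq).symm
      rw [A.collecting_none_root T (this.trans h), run]
    · obtain ⟨⟨d, a⟩, hda, -⟩ := T.existsUnique_edge _ h
      refine ⟨[a], ?_, fun q hq => ?_⟩
      · have h1 := T.isTransition _ _ _ hda
        simp only [quot, Quotient.lift_mk, Option.map_eq_some_iff] at h1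
        obtain ⟨p, hp, -⟩ := h1
        simp [hsome, hp]
      · have : A.cls q = A.cls p := (Quotient.sound hq).symm
        rw [hsome, A.collecting_none T (d := d) (a := a)]
        rw [this]
        exact hda

theorem collecting_run_eq_run (p : Q) (w : List (Option S)) :
    ∃ u, (A.run p u).isSome ∧ ∀ q, A.insep.r p q → (A.collecting T).run q w = A.run q u := by
  induction w generalizing p with
  | nil => exact ⟨[], rfl, fun q _ => rfl⟩
  | cons x w ih =>
    obtain ⟨u, hu, hu'⟩ := A.collecting_letter_eq_run T p x
    obtain ⟨p', hp'⟩ := Option.isSome_iff_exists.1 hu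
    obtain ⟨v, hv, hv'⟩ := ih p'
    refine ⟨u ++ v, by simpa [run_append, hp'] using hv, fun q hq => ?_⟩
    have h1 := A.insep_run hq u
    rw [hp', Option.map_some] at h1
    obtain ⟨q', hq', h2⟩ := Option.map_eq_some_iff.1 h1.symm
    rw [run_append, run, hu' q hq, hq', Option.bind_some, Option.bind_some]
    exact hv' q' (Quotient.exact h2.symm)

theorem collecting_run_of_run {q p : Q} {u : List S} (h : A.run q u = some p) :
    (A.collecting T).run q (u.map some) = some p := by
  induction u generalizing q with
  | nil => exact h
  | cons a u ih =>
    simp only [run, Option.bind_eq_some_iff, List.map_cons] at h ⊢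
    obtain ⟨r, hr, h⟩ := h
    exact ⟨r, by simp [collecting, fixing, hr], ih h⟩

/-- Enough copies of the fresh letter bring any state into the root class. -/
theorem collecting_run_replicate (q : Q) : ∃ N, ∀ m ≥ N, ∃ p,
    A.cls p = T.root ∧ (A.collecting T).run q (List.replicate m none) = some p := by
  have hroot : ∀ m q, A.cls q = T.root →
      (A.collecting T).run q (List.replicate m none) = some q := by
    intro m
    induction m with
    | zero => intro q _; rfl
    | succ m ih =>
      intro q hq
      rw [List.replicate_succ, run, A.collecting_none_root T hq, Option.bind_some, ih q hq]
  have H : ∀ c, Relation.ReflTransGen (fun c d => ∃ a, (c, d, a) ∈ T.edges) c T.root →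
      ∀ q, A.cls q = c → ∃ N, ∀ m ≥ N, ∃ p,
        A.cls p = T.root ∧ (A.collecting T).run q (List.replicate m none) = some p := by
    intro c hc
    induction hc using Relation.ReflTransGen.head_induction_on with
    | refl => exact fun q hq => ⟨0, fun m _ => ⟨q, hq, hroot m q hq⟩⟩
    | head h1 _ ih =>
      rintro q rfl
      obtain ⟨a, ha⟩ := h1
      have h2 := T.isTransition _ _ _ ha
      simp only [quot, Quotient.lift_mk, Option.map_eq_some_iff] at h2
      obtain ⟨p, hp, hp'⟩ := h2
      obtain ⟨N, hN⟩ := ih p hp'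
      refine ⟨N + 1, fun m hm => ?_⟩
      obtain ⟨m, rfl⟩ : ∃ m', m = m' + 1 := ⟨m - 1, by omega⟩
      obtain ⟨r, hr, hr'⟩ := hN m (by omega)
      refine ⟨r, hr, ?_⟩
      rw [List.replicate_succ, run, A.collecting_none T ha, hp, Option.bind_some, hr']
  exact H _ (T.reaches_root _) q rfl

/-- A collecting automaton of a strongly connected automaton is synchronizing if and only if the
automaton is. Powers of the fresh letter collect all states in the root class, from where a
synchronizing word can be applied. Conversely, a synchronizing word of the collecting automaton acts
on any class, in particular on one that contains the image of a word, as a word of the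
original automaton. -/
theorem collecting_synchronizing_iff [Finite Q] [Nonempty Q] (hA : A.StronglyConnected) :
    (A.collecting T).Synchronizing ↔ A.Synchronizing := by
  rw [synchronizing_iff, synchronizing_iff]
  constructor
  · rintro ⟨w, r, hw⟩
    obtain ⟨v, ⟨p, hp⟩, hv⟩ := A.exists_image_subset_class
    obtain ⟨u, hu, hu'⟩ := A.collecting_run_eq_run T p w
    refine ⟨v ++ u, r, ?_⟩
    have hsub : A.image Set.univ (v ++ u) ⊆ {r} := by
      rw [image_append, ← hw]
      rintro s ⟨q, hq, hs⟩
      exact ⟨q, Set.mem_univ _, by rw [hu' q (hv p hp q hq), hs]⟩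
    refine (Set.subset_singleton_iff_eq.1 hsub).resolve_left (Set.Nonempty.ne_empty ?_)
    obtain ⟨s, hs⟩ := Option.isSome_iff_exists.1 hu
    rw [image_append]
    exact ⟨s, p, hp, hs⟩
  · rintro ⟨w, r, hw⟩
    obtain ⟨r₀, hr₀⟩ : ∃ q, A.cls q = T.root := Quotient.exists_rep _
    have hr : r ∈ A.image Set.univ w := by rw [hw]; rfl
    obtain ⟨q₁, -, hq₁⟩ := hr
    obtain ⟨v, hv⟩ := hA r₀ q₁
    choose N hN using A.collecting_run_replicate T
    obtain ⟨m, hm⟩ := (Set.finite_range N).bddAbove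
    have hall : ∀ q, (A.collecting T).run q (List.replicate m none ++ (v ++ w).map some) = some r := by
      intro q
      obtain ⟨p, hp, hp'⟩ := hN q m (hm ⟨q, rfl⟩)
      rw [run_append, hp', Option.bind_some]
      have hins : A.insep.r r₀ p := Quotient.exact (hr₀.trans hp.symm)
      have hdef : (A.run p (v ++ w)).isSome :=
        (hins (v ++ w)).1 (by simp [run_append, hv, hq₁])
      obtain ⟨s, hs⟩ := Option.isSome_iff_exists.1 hdef
      rw [A.collecting_run_of_run T hs]
      have : s ∈ A.image Set.univ w := by
        rw [run_append, Option.bind_eq_some_iff] at hs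
        obtain ⟨s', -, hs'⟩ := hs
        exact ⟨s', Set.mem_univ _, hs'⟩
      rw [hw] at this
      rw [this]
    refine ⟨List.replicate m none ++ (v ++ w).map some, r, ?_⟩
    ext s
    constructor
    · rintro ⟨q, -, hq⟩
      rw [hall, Option.some.injEq] at hq
      exact hq.symm
    · rintro rfl
      exact ⟨r₀, Set.mem_univ _, hall _⟩

end collecting

section relabel

variable {S' : Type*}

theorem relabel_run (f : S' → S) (q : Q) (w : List S') :
    (A.relabel f).run q w = A.run q (w.map f) := by
  induction w generalizing q with
  | nil => rfl
  | cons a w ih => simp only [run, relabel, List.map_cons]; exact congrArg _ (funext ih)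

theorem relabel_synchronizing_iff (f : S' ≃ S) :
    (A.relabel f).Synchronizing ↔ A.Synchronizing := by
  have h : ∀ w, (A.relabel f).image Set.univ w = A.image Set.univ (w.map f) := by
    intro w; simp [image, relabel_run]
  simp only [synchronizing_iff, h]
  constructor
  · rintro ⟨w, hw⟩; exact ⟨_, hw⟩
  · rintro ⟨w, hw⟩; exact ⟨w.map f.symm, by simpa using hw⟩

end relabel

end PartialAutomaton

/-! ### Collecting trees from a choice of letters -/

namespace PartialAutomaton

section tree

variable {Q S : Type*} (A : PartialAutomaton Q S)

/-- The labelled edges between inseparability classes given by a choice `L` of letters for the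
states of all classes but that of `r`. -/
def labelEdges (L : Q → S → Prop) (r : Q) : Set (A.Class × A.Class × S) :=
  {e | ∃ p s, e.1 = A.cls p ∧ e.2.1 = A.cls s ∧ ¬A.insep.r p r ∧ L p e.2.2 ∧ A.δ p e.2.2 = some s}

theorem labelEdges_mono {L L' : Q → S → Prop} {r : Q}
    (h : ∀ p a, ¬A.insep.r p r → L p a → L' p a) : A.labelEdges L r ⊆ A.labelEdges L' r :=
  fun _ ⟨p, s, h1, h2, h3, h4, h5⟩ => ⟨p, s, h1, h2, h3, h p _ h3 h4, h5⟩

/-- A choice of letters that depends only on the class gives a collecting tree, as soon as the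
chosen transitions lead from every class to the root class. -/
theorem exists_collectingTree {L : Q → S → Prop} {r : Q}
    (hL : ∀ p q a, A.insep.r p q → L p a → L q a) (huniq : ∀ p a b, L p a → L p b → a = b)
    (hreach : ∀ p, Relation.ReflTransGen (fun c d => ∃ a, (c, d, a) ∈ A.labelEdges L r)
      (A.cls p) (A.cls r)) :
    ∃ T : A.CollectingTree, T.root = A.cls r ∧ T.edges = A.labelEdges L r := by
  refine ⟨⟨A.cls r, A.labelEdges L r, ?_, ?_, ?_, ?_⟩, rfl, rfl⟩
  · rintro c d a ⟨p, s, hc, hd, -, -, hs⟩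
    simp only at hc hd hs
    subst hc hd
    simp [quot, hs]
  · rintro d a ⟨p, s, hc, -, hr, -, -⟩
    exact hr (Quotient.exact hc.symm)
  · intro c hc
    obtain ⟨p, rfl⟩ := Quotient.exists_rep c
    obtain h | ⟨d, ⟨a, ha⟩, -⟩ := (hreach p).cases_head
    · exact absurd h hc
    refine ⟨(d, a), ha, ?_⟩
    rintro ⟨d', b⟩ ⟨q, s', hq, hd', -, hb, hs'⟩
    obtain ⟨p', s, hp', hd, -, ha, hs⟩ := ha
    simp only at hq hd' hb hs' hp' hd ha hs
    have hqp : A.insep.r q p' := Quotient.exact (hq.symm.trans hp')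
    obtain rfl := huniq _ _ _ ha (hL _ _ _ hqp hb)
    have := A.insep_step a q p' hqp
    rw [hs, hs', Option.map_some, Option.map_some, Option.some.injEq] at this
    rw [hd, hd', Prod.mk.injEq]
    exact ⟨this, rfl⟩
  · intro c
    obtain ⟨p, rfl⟩ := Quotient.exists_rep c
    exact hreach p

end tree

end PartialAutomaton

/-! ### Partitions as arrays -/

/-- The data structure for a partition of `{0, ..., n - 1}` into blocks `0, ..., nb - 1`. The array
`el` lists the elements so that each block `b` occupies the segment of length `sz b` that starts at
`fst b`; `pos` is the inverse of `el`, and `blk p` is the block of `p`. -/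
structure IsPartition (n : ℕ) (el pos blk fst sz : ℕ → ℕ) (nb : ℕ) : Prop where
  pos_lt : ∀ p < n, pos p < n
  el_lt : ∀ j < n, el j < n
  el_pos : ∀ p < n, el (pos p) = p
  pos_el : ∀ j < n, pos (el j) = j
  blk_lt : ∀ p < n, blk p < nb
  mem : ∀ p < n, fst (blk p) ≤ pos p ∧ pos p < fst (blk p) + sz (blk p)
  seg : ∀ b < nb, ∀ j, fst b ≤ j → j < fst b + sz b → j < n ∧ blk (el j) = b
  sz_pos : ∀ b < nb, 0 < sz b

namespace IsPartition

variable {n : ℕ} {el pos blk fst sz : ℕ → ℕ} {nb : ℕ}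

theorem seg_le (h : IsPartition n el pos blk fst sz nb) {b : ℕ} (hb : b < nb) :
    fst b + sz b ≤ n := by
  have h1 := h.sz_pos b hb
  have := (h.seg b hb (fst b + sz b - 1) (by omega) (by omega)).1
  omega

theorem nb_le (h : IsPartition n el pos blk fst sz nb) : nb ≤ n := by
  have hinj : Set.InjOn fst (Finset.range nb : Set ℕ) := by
    intro b hb b' hb' hbb
    simp only [Finset.coe_range, Set.mem_Iio] at hb hb'
    have h1 := h.seg b hb (fst b) le_rfl (by have := h.sz_pos b hb; omega)
    have h2 := h.seg b' hb' (fst b') le_rfl (by have := h.sz_pos b' hb'; omega)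
    rw [← h1.2, ← h2.2, hbb]
  have := Finset.card_le_card_of_injOn (t := Finset.range n) fst (fun b hb => by
    simp only [Finset.coe_range, Set.mem_Iio] at hb ⊢
    have := h.seg_le hb
    have := h.sz_pos b hb
    omega) hinj
  simpa using this

theorem pos_inj (h : IsPartition n el pos blk fst sz nb) {p q : ℕ} (hp : p < n) (hq : q < n)
    (hpq : pos p = pos q) : p = q := by
  rw [← h.el_pos p hp, ← h.el_pos q hq, hpq]

/-- The partition into a single block. -/
theorem single (hn : 0 < n) (hel : ∀ j < n, el j = j) (hpos : ∀ p < n, pos p = p)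
    (hblk : ∀ p < n, blk p = 0) (hfst : fst 0 = 0) (hsz : sz 0 = n) :
    IsPartition n el pos blk fst sz 1 where
  pos_lt p hp := by rw [hpos p hp]; exact hp
  el_lt j hj := by rw [hel j hj]; exact hj
  el_pos p hp := by rw [hpos p hp, hel p hp]
  pos_el j hj := by rw [hel j hj, hpos j hj]
  blk_lt p hp := by rw [hblk p hp]; exact Nat.one_pos
  mem p hp := by rw [hblk p hp, hfst, hsz, hpos p hp]; omega
  seg b hb j h1 h2 := by
    obtain rfl : b = 0 := by omega
    rw [hfst, hsz] at h2
    have hj : j < n := by omega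
    exact ⟨hj, by rw [hel j hj, hblk j hj]⟩
  sz_pos b hb := by
    obtain rfl : b = 0 := by omega
    omega

/-- Two elements of the same block exchange their places in the list of elements. -/
theorem swap (h : IsPartition n el pos blk fst sz nb) {p y : ℕ} (hp : p < n)
    (hy1 : fst (blk p) ≤ y) (hy2 : y < fst (blk p) + sz (blk p)) :
    IsPartition n (Function.update (Function.update el (pos p) (el y)) y p)
      (Function.update (Function.update pos (el y) (pos p)) p y) blk fst sz nb := by
  obtain ⟨hyn, hby⟩ := h.seg _ (h.blk_lt p hp) y hy1 hy2
  have hx := h.pos_lt p hp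
  have hq := h.el_lt y hyn
  have hpq : el y = p → y = pos p := fun e => by rw [← e, h.pos_el y hyn]
  refine ⟨?_, ?_, ?_, ?_, h.blk_lt, ?_, ?_, h.sz_pos⟩
  · intro r hr
    simp only [Function.update_apply]
    split_ifs
    · exact hyn
    · exact hx
    · exact h.pos_lt r hr
  · intro j hj
    simp only [Function.update_apply]
    split_ifs
    · exact hp
    · exact hq
    · exact h.el_lt j hj
  · intro r hr
    simp only [Function.update_apply]
    by_cases h1 : r = p
    · simp [h1]
    · by_cases h2 : r = el y
      · rw [if_neg h1, if_pos h2, if_pos rfl, if_neg, h2]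
        intro h3
        exact h1 (by rw [h2, ← h3, h.el_pos p hp])
      · simp only [h1, h2, if_false]
        rw [if_neg, if_neg, h.el_pos r hr]
        · exact fun e => h1 (h.pos_inj hr hp e)
        · rintro rfl
          exact h2 (h.el_pos r hr).symm
  · intro j hj
    simp only [Function.update_apply]
    by_cases h1 : j = y
    · simp [h1]
    · by_cases h2 : j = pos p
      · rw [if_neg h1, if_pos h2, if_neg, if_pos rfl, h2]
        exact fun e => h1 (by rw [h2, hpq e])
      · simp only [h1, h2, if_false]
        rw [if_neg, if_neg, h.pos_el j hj]
        · exact fun e => h1 (by rw [← h.pos_el j hj, e, h.pos_el y hyn])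
        · exact fun e => h2 (by rw [← e, h.pos_el j hj])
  · intro r hr
    simp only [Function.update_apply]
    split_ifs with h1 h2
    · rw [h1]; exact ⟨hy1, hy2⟩
    · rw [h2, hby]; exact h.mem p hp
    · exact h.mem r hr
  · intro b hb j h1 h2
    refine ⟨(h.seg b hb j h1 h2).1, ?_⟩
    have h3 := (h.seg b hb j h1 h2).2
    simp only [Function.update_apply]
    split_ifs with h4 h5
    · rw [← h3, h4, hby]
    · rw [hby, ← h3, h5, h.el_pos p hp]
    · exact h3

/-- A proper nonempty subsegment `[lo, lo + len)` at the beginning or the end of the segment of the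
block `b` becomes the new block `nb`. -/
theorem split (h : IsPartition n el pos blk fst sz nb) {b lo len f : ℕ} (hb : b < nb)
    (hlen : 0 < len) (hlen' : len < sz b)
    (hlo : lo = fst b ∧ f = fst b + len ∨ lo + len = fst b + sz b ∧ f = fst b) {blk' : ℕ → ℕ}
    (hblk : ∀ p < n, blk' p = if lo ≤ pos p ∧ pos p < lo + len then nb else blk p) :
    IsPartition n el pos blk' (Function.update (Function.update fst b f) nb lo)
      (Function.update (Function.update sz b (sz b - len)) nb len) (nb + 1) := by
  have hin : ∀ p < n, lo ≤ pos p → pos p < lo + len → blk p = b := by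
    intro p hp h1 h2
    have := (h.seg b hb (pos p) (by omega) (by omega)).2
    rwa [h.el_pos p hp] at this
  refine ⟨h.pos_lt, h.el_lt, h.el_pos, h.pos_el, ?_, ?_, ?_, ?_⟩
  · intro p hp
    have := h.blk_lt p hp
    rw [hblk p hp]
    split_ifs <;> omega
  · intro p hp
    have h1 := h.blk_lt p hp
    have h2 := h.mem p hp
    rw [hblk p hp]
    simp only [Function.update_apply]
    by_cases h3 : blk p = b
    · rw [h3] at h2
      split_ifs <;> omega
    · split_ifs <;> omega
  · intro b' hb' j
    simp only [Function.update_apply]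
    by_cases h1 : b' = nb
    · simp only [h1, if_true]
      intro h2 h3
      have h4 := (h.seg b hb j (by omega) (by omega)).1
      refine ⟨h4, ?_⟩
      rw [hblk _ (h.el_lt j h4), h.pos_el j h4, if_pos ⟨h2, h3⟩]
    · simp only [h1, if_false]
      by_cases h2 : b' = b
      · simp only [h2, if_true]
        intro h3 h4
        obtain ⟨h5, h6⟩ := h.seg b hb j (by omega) (by omega)
        refine ⟨h5, ?_⟩
        rw [hblk _ (h.el_lt j h5), h.pos_el j h5, if_neg (by omega), h6]
      · simp only [h2, if_false]
        intro h3 h4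
        obtain ⟨h5, h6⟩ := h.seg b' (by omega) j h3 h4
        refine ⟨h5, ?_⟩
        rw [hblk _ (h.el_lt j h5), h.pos_el j h5, if_neg, h6]
        intro h7
        have := hin _ (h.el_lt j h5) (by rw [h.pos_el j h5]; exact h7.1)
          (by rw [h.pos_el j h5]; exact h7.2)
        omega
  · intro b' hb'
    simp only [Function.update_apply]
    split_ifs <;> try omega
    exact h.sz_pos b' (by omega)

end IsPartition

/-! ### Linked lists of the transitions with a given target -/

theorem mul_add_lt_mul {n k s a : ℕ} (hs : s < n) (ha : a < k) : s * k + a < n * k := by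
  calc s * k + a < s * k + k := by omega
    _ = (s + 1) * k := by ring
    _ ≤ n * k := Nat.mul_le_mul_right k hs

theorem mul_add_div_of_lt {k a : ℕ} (s : ℕ) (ha : a < k) : (s * k + a) / k = s := by
  rw [Nat.mul_comm, Nat.mul_add_div (by omega), Nat.div_eq_of_lt ha, Nat.add_zero]

theorem mul_add_mod_self_of_lt {k a : ℕ} (s : ℕ) (ha : a < k) : (s * k + a) % k = a := by
  rw [Nat.mul_comm, Nat.mul_add_mod, Nat.mod_eq_of_lt ha]

theorem mul_add_inj {k s a s' a' : ℕ} (ha : a < k) (ha' : a' < k)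
    (h : s * k + a = s' * k + a') : s = s' ∧ a = a' := by
  have h1 := congrArg (· / k) h
  have h2 := congrArg (· % k) h
  simp only [mul_add_div_of_lt _ ha, mul_add_div_of_lt _ ha', mul_add_mod_self_of_lt _ ha,
    mul_add_mod_self_of_lt _ ha'] at h1 h2
  exact ⟨h1, h2⟩

/-- The linked list that starts at `e`, with successor function `nx`, runs through the elements of
`l`. A pointer to `j` is stored as `j + 1`, and `0` is the null pointer. -/
def Chain (nx : ℕ → ℕ) : ℕ → List ℕ → Prop
  | e, [] => e = 0
  | e, j :: l => e = j + 1 ∧ Chain nx (nx j) l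

theorem Chain.congr {nx nx' : ℕ → ℕ} {e : ℕ} {l : List ℕ} (h : Chain nx e l)
    (hnx : ∀ j ∈ l, nx' j = nx j) : Chain nx' e l := by
  induction l generalizing e with
  | nil => exact h
  | cons j l ih =>
    refine ⟨h.1, ?_⟩
    rw [hnx j (by simp)]
    exact ih h.2 fun i hi => hnx i (by simp [hi])

theorem Chain.le {nx : ℕ → ℕ} {e m : ℕ} {l : List ℕ} (h : Chain nx e l) (hl : ∀ j ∈ l, j < m) :
    e ≤ m := by
  cases l with
  | nil => exact h ▸ Nat.zero_le m
  | cons j l => rw [h.1]; exact hl j (by simp)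

/-- An entry `j < n * k` of the transition table stands for the transition of the state `j / k`
under the letter `j % k`. This is the list of the entries below `m` whose transition is defined and
leads, under the letter `a`, to the state `s`, where `x = s * k + a`. -/
def inEdges (tb : ℕ → ℕ) (k x m : ℕ) : List ℕ :=
  ((List.range m).filter fun j => tb j ≠ 0 ∧ (tb j - 1) * k + j % k = x).reverse

theorem mem_inEdges {tb : ℕ → ℕ} {k x m j : ℕ} :
    j ∈ inEdges tb k x m ↔ j < m ∧ tb j ≠ 0 ∧ (tb j - 1) * k + j % k = x := by
  simp [inEdges]

theorem nodup_inEdges (tb : ℕ → ℕ) (k x m : ℕ) : (inEdges tb k x m).Nodup :=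
  List.nodup_reverse.2 (List.nodup_range.filter _)

theorem inEdges_succ (tb : ℕ → ℕ) (k x m : ℕ) : inEdges tb k x (m + 1) =
    if tb m ≠ 0 ∧ (tb m - 1) * k + m % k = x then m :: inEdges tb k x m else inEdges tb k x m := by
  simp only [inEdges, List.range_succ, List.filter_append, List.reverse_append]
  split_ifs with h
  · rw [List.filter_cons_of_pos (by simpa using h)]; simp
  · rw [List.filter_cons_of_neg (by simpa using h)]; simp

/-- Every transition occurs in at most one of the lists of incoming transitions. -/
theorem sum_length_inEdges_le (tb : ℕ → ℕ) (k N m : ℕ) :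
    ∑ x ∈ Finset.range N, (inEdges tb k x m).length ≤ m := by
  induction m with
  | zero => simp [inEdges]
  | succ m ih =>
    have : ∀ x, (inEdges tb k x (m + 1)).length ≤
        (inEdges tb k x m).length + if x = (tb m - 1) * k + m % k then 1 else 0 := by
      intro x
      rw [inEdges_succ]
      split_ifs with h1 h2 h2
      · simp
      · exact absurd h1.2.symm h2
      · omega
      · omega
    calc _ ≤ _ := Finset.sum_le_sum fun x _ => this x
      _ ≤ m + 1 := by
        rw [Finset.sum_add_distrib, Finset.sum_ite_eq']
        split_ifs <;> omega

namespace RAM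

-- The arrays. For the number `x = s * k + a`, `aHead x` points to the list of the transitions into
-- the state `s` under the letter `a`, and `aNext` contains the links of these lists. The arrays `aEl`,
-- `aPos`, `aBlk`, `aFst` and `aSz` hold the partition, see `IsPartition`, `aMk` the numbers of marked
-- elements of the blocks, `aList` the elements to be marked, and `aTch` the blocks with a marked
-- element. The arrays `aQueue`, `aVis` and `aLab` belong to the backward search, see `IsSearch`.
notation "aTab" => (1 : ℕ)
notation "aOut" => (3 : ℕ)
notation "aHead" => (4 : ℕ)
notation "aNext" => (5 : ℕ)
notation "aEl" => (6 : ℕ)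
notation "aPos" => (7 : ℕ)
notation "aBlk" => (8 : ℕ)
notation "aFst" => (9 : ℕ)
notation "aSz" => (10 : ℕ)
notation "aMk" => (11 : ℕ)
notation "aList" => (12 : ℕ)
notation "aTch" => (13 : ℕ)
notation "aQueue" => (14 : ℕ)
notation "aVis" => (15 : ℕ)
notation "aLab" => (16 : ℕ)

-- Scalar variables, each held in cell `0` of an array of its own. In particular, `sC` is the counter
-- of pairs, `sNb` the number of blocks, `sCnt`, `sTc` and `sQn` are the lengths of `aList`,
-- `aTch` and `aQueue`, and `sE` is the pointer into a linked list.
notation "sI" => (20 : ℕ)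
notation "sX" => (21 : ℕ)
notation "sC" => (22 : ℕ)
notation "sNb" => (23 : ℕ)
notation "sCnt" => (24 : ℕ)
notation "sTc" => (25 : ℕ)
notation "sB" => (26 : ℕ)
notation "sJ" => (27 : ℕ)
notation "sEnd" => (28 : ℕ)
notation "sE" => (29 : ℕ)
notation "sP" => (30 : ℕ)
notation "sY" => (31 : ℕ)
notation "sQ" => (32 : ℕ)
notation "sM" => (33 : ℕ)
notation "sLen" => (34 : ℕ)
notation "sA" => (35 : ℕ)
notation "sQn" => (36 : ℕ)

/-- The number of states. -/
abbrev eN : Expr := .read 0 0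
/-- The number of letters. -/
abbrev eK : Expr := .read 0 1

open RAM.Expr

/-- Collect the transitions in linked lists, one for each target state and letter. -/
def linkEdges : Prog :=
  .write sI 0 0 ;;
  .loop (lt (var sI) (eN * eK))
    (.cond (.read aTab (var sI))
      (.write sX 0 ((.read aTab (var sI) - 1) * eK + var sI % eK) ;;
       .write aNext (var sI) (.read aHead (var sX)) ;;
       .write aHead (var sX) (var sI + 1))
      .skip ;;
    .write sI 0 (var sI + 1))

-- The runs of loop-free programs are computed by `simp`. What remains is a conjunction that begins with
-- bounds for the occurring numbers and for the time; these are left to `omega`.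
theorem wp_linkEdges {W n k : ℕ} (hW : 4 * (n * k + n + k + 1) < W) {M : Memory}
    (hn : M 0 0 = n) (hk : M 0 1 = k) (htb : ∀ j < n * k, M aTab j ≤ n)
    (hhead : ∀ x, M aHead x = 0) :
    WP W linkEdges M fun t M' => t ≤ 60 * (n * k) + 12 ∧
      (∀ x, Chain (M' aNext) (M' aHead x) (inEdges (M aTab) k x (n * k))) ∧
      Frame [aHead, aNext, sI, sX] M M' := by
  rw [linkEdges, wp_seq, wp_write]
  refine ⟨by simp; omega, by simp; omega, ?_⟩
  simp only [eval_zero]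
  refine wp_loop_count (n * k) (fun i t M' => t ≤ 60 * i ∧ M' sI 0 = i ∧
    (∀ x, Chain (M' aNext) (M' aHead x) (inEdges (M aTab) k x i)) ∧
      Frame [aHead, aNext, sI, sX] M M') ?_ ?_ ?_ ?_ ?_
  · refine ⟨le_rfl, by simp, fun x => ?_, (Frame.refl _ _).set⟩
    simpa [inEdges, Chain] using hhead x
  · rintro i t M' hi ⟨ht, hi', hch, hf⟩
    simp [hi', hf.get 0, hn, hk]
    split_ifs <;> omega
  · rintro i t M' hi ⟨ht, hi', hch, hf⟩
    simp [hi', hf.get 0, hn, hk]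
  · rintro i t M' hi ⟨ht, hi', hch, hf⟩
    have h0 := hf.get 0
    have h1 := hf.get aTab
    have hk0 : 0 < k := Nat.pos_of_ne_zero (by rintro rfl; simp at hi)
    have hmod : i % k < k := Nat.mod_lt _ hk0
    have htb' := htb i hi
    rw [wp_seq, wp_cond]
    refine ⟨by simp [hi', h1]; omega, fun h => ?_, fun h => ?_⟩
    · simp only [eval_read, eval_zero, hi', h1] at h
      have hx : (M aTab i - 1) * k + i % k < n * k := mul_add_lt_mul (by omega) hmod
      have hle : M' aHead ((M aTab i - 1) * k + i % k) ≤ i :=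
        (hch _).le fun j hj => (mem_inEdges.1 hj).1
      simp only [wp_seq, wp_write]
      simp [hi', h1, h0, hk]
      refine ⟨by omega, by omega, by omega, by omega, by omega, by omega, by omega, by omega,
        by omega, fun x => ?_, hf.set.set.set.set⟩
      have hold : ∀ x, Chain (Function.update (M' aNext) i
          (M' aHead ((M aTab i - 1) * k + i % k))) (M' aHead x) (inEdges (M aTab) k x i) :=
        fun x => (hch x).congr fun j hj =>
          Function.update_of_ne (by have := (mem_inEdges.1 hj).1; omega) _ _
      rw [inEdges_succ]
      by_cases hxx : (M aTab i - 1) * k + i % k = x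
      · rw [if_pos ⟨h, hxx⟩, ← hxx, Function.update_self]
        refine ⟨rfl, ?_⟩
        rw [Function.update_self]
        exact hold _
      · rw [if_neg fun h => hxx h.2, Function.update_of_ne (Ne.symm hxx)]
        exact hold x
    · simp only [eval_read, eval_zero, hi', h1] at h
      simp only [wp_skip, wp_write]
      simp [hi']
      refine ⟨by omega, by omega, by omega, fun x => ?_, hf.set⟩
      rw [inEdges_succ, if_neg (by simp [h])]
      exact hch x
  · rintro t M' ⟨ht, hi', hch, hf⟩
    refine ⟨?_, hch, hf⟩
    simp
    omega

end RAM

/-! ### The initial partition, and the predecessors of a block -/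

/-- The states with a transition under the letter `a` to one of the states `el lo, ...,
el (lo + m - 1)`. -/
def predList (tb el : ℕ → ℕ) (n k a lo m : ℕ) : List ℕ :=
  (List.range m).flatMap fun j => (inEdges tb k (el (lo + j) * k + a) (n * k)).map (· / k)

theorem predList_succ (tb el : ℕ → ℕ) (n k a lo m : ℕ) : predList tb el n k a lo (m + 1) =
    predList tb el n k a lo m ++
      (inEdges tb k (el (lo + m) * k + a) (n * k)).map (· / k) := by
  simp [predList, List.range_succ]

theorem mem_inEdges_map {tb : ℕ → ℕ} {n k a s p : ℕ} (ha : a < k) :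
    p ∈ (inEdges tb k (s * k + a) (n * k)).map (· / k) ↔
      p < n ∧ tb (p * k + a) = s + 1 := by
  have hk : 0 < k := by omega
  simp only [List.mem_map, mem_inEdges]
  constructor
  · rintro ⟨j, ⟨h1, h2, h3⟩, rfl⟩
    obtain ⟨h4, h5⟩ := mul_add_inj (Nat.mod_lt _ hk) ha h3
    refine ⟨Nat.div_lt_of_lt_mul (by rwa [Nat.mul_comm]), ?_⟩
    rw [← h5, Nat.div_add_mod' j k]
    omega
  · rintro ⟨h1, h2⟩
    have h3 := mul_add_div_of_lt p ha
    have h4 := mul_add_mod_self_of_lt p ha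
    exact ⟨p * k + a, ⟨mul_add_lt_mul h1 ha, by omega, by rw [h2, h4]; simp⟩, h3⟩

theorem mem_predList {tb el : ℕ → ℕ} {n k a lo m p : ℕ} (ha : a < k) :
    p ∈ predList tb el n k a lo m ↔ p < n ∧ ∃ j < m, tb (p * k + a) = el (lo + j) + 1 := by
  simp only [predList, List.mem_flatMap, List.mem_range, mem_inEdges_map ha]
  tauto

theorem nodup_predList {tb el : ℕ → ℕ} {n k a lo m : ℕ} (ha : a < k)
    (hel : ∀ i < m, ∀ j < m, el (lo + i) = el (lo + j) → i = j) :
    (predList tb el n k a lo m).Nodup := by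
  have hk : 0 < k := by omega
  refine List.nodup_flatMap.2 ⟨fun j _ => (nodup_inEdges _ _ _ _).map_on ?_, ?_⟩
  · intro e he e' he' h
    have h1 := (mul_add_inj (Nat.mod_lt _ hk) ha (mem_inEdges.1 he).2.2).2
    have h2 := (mul_add_inj (Nat.mod_lt _ hk) ha (mem_inEdges.1 he').2.2).2
    rw [← Nat.div_add_mod' e k, ← Nat.div_add_mod' e' k, h, h1, h2]
  · refine List.nodup_range.pairwise_of_forall_ne fun i hi j hj hij p hp hq => hij ?_
    rw [mem_inEdges_map ha] at hp hq
    rw [List.mem_range] at hi hj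
    exact hel i hi j hj (by omega)

theorem length_predList_le {tb el : ℕ → ℕ} {n k a lo m : ℕ} (ha : a < k)
    (hel : ∀ i < m, ∀ j < m, el (lo + i) = el (lo + j) → i = j) :
    (predList tb el n k a lo m).length ≤ n := by
  have h1 : predList tb el n k a lo m ⊆ List.range n := fun p hp =>
    List.mem_range.2 ((mem_predList ha).1 hp).1
  simpa using ((nodup_predList ha hel).subperm h1).length_le

theorem length_predList (tb el : ℕ → ℕ) (n k a lo m : ℕ) :
    (predList tb el n k a lo m).length =
      ∑ j ∈ Finset.range m, (inEdges tb k (el (lo + j) * k + a) (n * k)).length := by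
  induction m with
  | zero => simp [predList]
  | succ m ih => rw [predList_succ, Finset.sum_range_succ, List.length_append, List.length_map, ih]

theorem map_range_update (f : ℕ → ℕ) (m v : ℕ) :
    (List.range (m + 1)).map (Function.update f m v) = (List.range m).map f ++ [v] := by
  rw [List.range_succ, List.map_append, List.map_singleton, Function.update_self]
  congr 1
  refine List.map_congr_left fun i hi => Function.update_of_ne ?_ _ _
  have := List.mem_range.1 hi
  omega

namespace RAM

open RAM.Expr

/-- Set up the partition into a single block, and start the counter `sC` of pairs of a block and a
letter. -/
def initPartition : Prog :=
  .write sI 0 0 ;;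
  .loop (lt (var sI) eN)
    (.write aEl (var sI) (var sI) ;; .write aPos (var sI) (var sI) ;;
     .write sI 0 (var sI + 1)) ;;
  .write aSz 0 eN ;; .write sNb 0 1 ;; .write sC 0 0

theorem wp_initPartition {W n : ℕ} (hW : n + 1 < W) (hn0 : 0 < n) {M : Memory}
    (hn : M 0 0 = n) (hblk : ∀ p, M aBlk p = 0) (hfst : M aFst 0 = 0) :
    WP W initPartition M fun t M' => t ≤ 30 * n + 50 ∧
      IsPartition n (M' aEl) (M' aPos) (M' aBlk) (M' aFst) (M' aSz) 1 ∧
      M' sNb 0 = 1 ∧ M' sC 0 = 0 ∧ Frame [aEl, aPos, aSz, sI, sNb, sC] M M' := by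
  rw [initPartition, wp_seq, wp_write]
  refine ⟨by simp; omega, by simp; omega, ?_⟩
  simp only [eval_zero]
  rw [wp_seq]
  refine wp_loop_count n (fun i t M' => t ≤ 30 * i ∧ M' sI 0 = i ∧
    (∀ j < i, M' aEl j = j ∧ M' aPos j = j) ∧ Frame [aEl, aPos, sI] M M') ?_ ?_ ?_ ?_ ?_
  · exact ⟨le_rfl, by simp, by simp, (Frame.refl _ _).set⟩
  · rintro i t M' hi ⟨ht, hi', hch, hf⟩
    simp [hi', hf.get 0, hn]
    split_ifs <;> omega
  · rintro i t M' hi ⟨ht, hi', hch, hf⟩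
    simp [hi', hf.get 0, hn]
  · rintro i t M' hi ⟨ht, hi', hch, hf⟩
    simp only [wp_seq, wp_write]
    simp [hi']
    repeat refine ⟨by omega, ?_⟩
    refine ⟨fun j hj => ?_, hf.set.set.set⟩
    by_cases h : j = i
    · simp [h]
    · simpa [h] using hch j (by omega)
  · rintro t M' ⟨ht, hi', hch, hf⟩
    simp only [wp_seq, wp_write]
    simp [hf.get 0, hn]
    repeat refine ⟨by omega, ?_⟩
    refine ⟨.single hn0 (fun j hj => (hch j hj).1) (fun j hj => (hch j hj).2) (fun p _ => ?_) ?_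
      (by simp), ?_⟩
    · rw [hf.get aBlk, hblk]
    · rw [hf.get aFst, hfst]
    · exact (Frame.refl _ M).trans (l' := [aEl, aPos, aSz, sI, sNb, sC])
        ((Frame.trans (Frame.refl _ _) hf).set.set.set)

/-- Collect in `aList` the states that have a transition under the letter `sA` into the block
`sB`. -/
def collectPreds : Prog :=
  .write sJ 0 (.read aFst (var sB)) ;;
  .write sEnd 0 (.read aFst (var sB) + .read aSz (var sB)) ;;
  .write sCnt 0 0 ;;
  .loop (lt (var sJ) (var sEnd))
    (.write sE 0 (.read aHead (.read aEl (var sJ) * eK + var sA)) ;;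
     .loop (var sE)
       (.write aList (var sCnt) ((var sE - 1) / eK) ;; .write sCnt 0 (var sCnt + 1) ;;
        .write sE 0 (.read aNext (var sE - 1))) ;;
     .write sJ 0 (var sJ + 1))

theorem wp_collectChain {W n k : ℕ} (hW : 4 * (n * k + n + k + 1) < W) {M : Memory} {l : List ℕ}
    (hk : M 0 1 = k) (hch : Chain (M aNext) (M sE 0) l) (hl : ∀ j ∈ l, j < n * k)
    (hcnt : M sCnt 0 + l.length ≤ n) :
    WP W (.loop (var sE)
       (.write aList (var sCnt) ((var sE - 1) / eK) ;; .write sCnt 0 (var sCnt + 1) ;;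
        .write sE 0 (.read aNext (var sE - 1)))) M fun t M' => t ≤ 40 * l.length + 3 ∧
      M' sCnt 0 = M sCnt 0 + l.length ∧
      (List.range (M' sCnt 0)).map (M' aList) =
        (List.range (M sCnt 0)).map (M aList) ++ l.map (· / k) ∧
      Frame [aList, sCnt, sE] M M' := by
  refine wp_loop_count l.length (fun i t M' => t ≤ 40 * i ∧
    Chain (M aNext) (M' sE 0) (l.drop i) ∧ M' sCnt 0 = M sCnt 0 + i ∧
    (List.range (M' sCnt 0)).map (M' aList) =
        (List.range (M sCnt 0)).map (M aList) ++ (l.take i).map (· / k) ∧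
    Frame [aList, sCnt, sE] M M') ?_ ?_ ?_ ?_ ?_
  · exact ⟨le_rfl, by simpa using hch, by simp, by simp, Frame.refl _ _⟩
  · rintro i t M' hi ⟨ht, hch', hi', hlist, hf⟩
    have := hch'.le fun j hj => hl j (List.mem_of_mem_drop hj)
    simp
    omega
  · rintro i t M' hi ⟨ht, hch', hi', hlist, hf⟩
    simp only [eval_read, eval_zero]
    obtain rfl | hi := hi.eq_or_lt
    · simpa [Chain] using hch'
    · rw [List.drop_eq_getElem_cons hi] at hch'
      simp [hch'.1, hi]
  · rintro i t M' hi ⟨ht, hch', hi', hlist, hf⟩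
    rw [List.drop_eq_getElem_cons hi] at hch'
    have h1 := hl l[i] (List.getElem_mem hi)
    have h2 := hch'.2.le fun j hj => hl j (List.mem_of_mem_drop hj)
    have h3 : l[i] / k ≤ l[i] := Nat.div_le_self _ _
    have h4 := hch'.1
    simp only [wp_seq, wp_write]
    simp [hf.get 0, hf.get aNext, hk, h4]
    repeat refine ⟨by omega, ?_⟩
    refine ⟨hch'.2, by omega, ?_, hf.set.set.set⟩
    rw [map_range_update, hlist, List.take_add_one, List.append_assoc]
    simp [List.getElem?_eq_getElem hi]
  · rintro t M' ⟨ht, hch', hi', hlist, hf⟩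
    rw [List.take_length] at hlist
    exact ⟨by simp; omega, hi', hlist, hf⟩

theorem wp_collectPreds {W n k : ℕ} (hW : 4 * (n * k + n + k + 1) < W) {M : Memory}
    {tb pos blk : ℕ → ℕ} {nb a b : ℕ} (hk : M 0 1 = k)
    (hch : ∀ x, Chain (M aNext) (M aHead x) (inEdges tb k x (n * k)))
    (hpart : IsPartition n (M aEl) pos blk (M aFst) (M aSz) nb) (hb : b < nb) (ha : a < k)
    (hsB : M sB 0 = b) (hsA : M sA 0 = a) :
    WP W collectPreds M fun t M' =>
      t ≤ 60 * M aSz b + 40 * (predList tb (M aEl) n k a (M aFst b) (M aSz b)).length + 30 ∧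
      M' sCnt 0 = (predList tb (M aEl) n k a (M aFst b) (M aSz b)).length ∧
      (List.range (M' sCnt 0)).map (M' aList) =
        predList tb (M aEl) n k a (M aFst b) (M aSz b) ∧
      Frame [aList, sCnt, sE, sJ, sEnd] M M' := by
  have hseg := hpart.seg_le hb
  have hnb := hpart.nb_le
  have hel : ∀ m ≤ M aSz b, ∀ i < m, ∀ j < m, M aEl (M aFst b + i) = M aEl (M aFst b + j) → i = j := by
    intro m hm i hi j hj h
    have h1 := hpart.pos_el (M aFst b + i) (by omega)
    have h2 := hpart.pos_el (M aFst b + j) (by omega)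
    rw [h] at h1
    omega
  rw [collectPreds]
  simp only [wp_seq, wp_write]
  simp [hsB]
  repeat refine ⟨by omega, ?_⟩
  refine wp_loop_count (M aSz b) (fun i t M' => t ≤ 60 * i +
      40 * (predList tb (M aEl) n k a (M aFst b) i).length ∧
    M' sJ 0 = M aFst b + i ∧ M' sEnd 0 = M aFst b + M aSz b ∧
    M' sCnt 0 = (predList tb (M aEl) n k a (M aFst b) i).length ∧
      (List.range (M' sCnt 0)).map (M' aList) = predList tb (M aEl) n k a (M aFst b) i ∧
      Frame [aList, sCnt, sE, sJ, sEnd] M M') ?_ ?_ ?_ ?_ ?_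
  · refine ⟨by simp, by simp, by simp, by simp [predList], by simp [predList], ?_⟩
    exact (Frame.refl _ _).set.set.set
  · rintro i t M' hi ⟨ht, hj, he, -, -, hf⟩
    simp [hj, he]
    split_ifs <;> omega
  · rintro i t M' hi ⟨ht, hj, he, -, -, hf⟩
    simp [hj, he]
  · rintro i t M' hi ⟨ht, hj, he, hcnt, hlist, hf⟩
    have h1 := hpart.el_lt (M aFst b + i) (by omega)
    have h2 := mul_add_lt_mul h1 ha
    have h3 := (hch (M aEl (M aFst b + i) * k + a)).le fun j hj => (mem_inEdges.1 hj).1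
    have h4 := length_predList_le (tb := tb) (n := n) ha (hel (i + 1) hi)
    rw [predList_succ, List.length_append, List.length_map] at h4
    simp only [wp_seq, wp_write]
    simp [hj, hf.get aEl, hf.get 0, hf.get sA, hf.get aHead, hk, hsA]
    repeat refine ⟨by omega, ?_⟩
    refine ((wp_collectChain (n := n) (k := k) hW (by simp [hf.get 0, hk])
      (l := inEdges tb k (M aEl (M aFst b + i) * k + a) (n * k)) ?_
      (fun j hj => (mem_inEdges.1 hj).1) ?_).mono ?_)
    · simpa [hf.get aNext] using hch _
    · simpa [hcnt] using h4
    · rintro t' M'' ⟨ht', hcnt', hlist', hf'⟩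
      rw [hlist'] at *
      simp [hf'.get sJ, hj, hf'.get sEnd, he, predList_succ, hcnt', hcnt] at hlist ⊢
      repeat refine ⟨by omega, ?_⟩
      exact (hf.set.trans hf').set
  · rintro t M' ⟨ht, hj, he, hcnt, hlist, hf⟩
    refine ⟨?_, hcnt, hlist, hf⟩
    simp
    omega

end RAM

/-! ### Marking elements of blocks -/

/-- The entries `i, ..., tc - 1` of the array `tch` list, without repetition, all blocks `b` with
`mk b ≠ 0`, and all of these are below `nb`. -/
structure Touched (mk tch : ℕ → ℕ) (nb i tc : ℕ) : Prop where
  lt : ∀ j, i ≤ j → j < tc → tch j < nb ∧ mk (tch j) ≠ 0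
  inj : ∀ j j', i ≤ j → j < tc → i ≤ j' → j' < tc → tch j = tch j' → j = j'
  surj : ∀ b, mk b ≠ 0 → ∃ j, i ≤ j ∧ j < tc ∧ tch j = b

theorem Touched.push {mk tch : ℕ → ℕ} {nb i tc b v : ℕ} (h : Touched mk tch nb i tc)
    (hi : i ≤ tc) (hb : b < nb) (hmk : mk b = 0) (hv : v ≠ 0) :
    Touched (Function.update mk b v) (Function.update tch tc b) nb i (tc + 1) := by
  have hne : ∀ j, i ≤ j → j < tc → tch j ≠ b := fun j h1 h2 h3 =>
    (h.lt j h1 h2).2 (h3 ▸ hmk)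
  refine ⟨fun j h1 h2 => ?_, fun j j' h1 h2 h3 h4 h5 => ?_, fun b' hb' => ?_⟩
  · by_cases h3 : j = tc
    · simp [h3, hb, hv]
    · have := h.lt j h1 (by omega)
      simpa [h3, hne j h1 (by omega)] using this
  · by_cases h6 : j = tc <;> by_cases h7 : j' = tc
    · omega
    · simp only [h6, Function.update_self, Function.update_of_ne h7] at h5
      exact absurd h5.symm (hne j' h3 (by omega))
    · simp only [h7, Function.update_self, Function.update_of_ne h6] at h5
      exact absurd h5 (hne j h1 (by omega))
    · simp only [Function.update_of_ne h6, Function.update_of_ne h7] at h5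
      exact h.inj j j' h1 (by omega) h3 (by omega) h5
  · by_cases h1 : b' = b
    · exact ⟨tc, by omega, by omega, by simp [h1]⟩
    · rw [Function.update_of_ne h1] at hb'
      obtain ⟨j, h2, h3, h4⟩ := h.surj b' hb'
      exact ⟨j, h2, by omega, by rw [Function.update_of_ne (by omega), h4]⟩

theorem Touched.incr {mk tch : ℕ → ℕ} {nb i tc b v : ℕ} (h : Touched mk tch nb i tc)
    (hmk : mk b ≠ 0) (hv : v ≠ 0) : Touched (Function.update mk b v) tch nb i tc := by
  refine ⟨fun j h1 h2 => ⟨(h.lt j h1 h2).1, ?_⟩, h.inj, fun b' hb' => ?_⟩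
  · have := (h.lt j h1 h2).2
    rw [Function.update_apply]
    split_ifs <;> assumption
  · refine h.surj b' ?_
    rw [Function.update_apply] at hb'
    split_ifs at hb' with h1
    · rwa [h1]
    · exact hb'

theorem Touched.pop {mk tch : ℕ → ℕ} {nb i tc : ℕ} (h : Touched mk tch nb i tc) (hi : i < tc) :
    Touched (Function.update mk (tch i) 0) tch nb (i + 1) tc := by
  refine ⟨fun j h1 h2 => ?_, fun j j' h1 h2 h3 h4 h5 => ?_, fun b' hb' => ?_⟩
  · have h3 : tch j ≠ tch i := fun h3 => by
      have := h.inj j i (by omega) h2 le_rfl hi h3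
      omega
    rw [Function.update_of_ne h3]
    exact h.lt j (by omega) h2
  · exact h.inj j j' (by omega) h2 (by omega) h4 h5
  · rw [Function.update_apply] at hb'
    split_ifs at hb' with h1
    · exact absurd rfl hb'
    · obtain ⟨j, h2, h3, h4⟩ := h.surj b' hb'
      refine ⟨j, ?_, h3, h4⟩
      have : j ≠ i := by rintro rfl; exact h1 h4.symm
      omega

/-- In each block the elements of `L` have been moved to the beginning of its segment, and `mk`
counts them. -/
structure IsMarked (n : ℕ) (el pos blk fst sz mk : ℕ → ℕ) (nb : ℕ) (L : List ℕ) : Prop where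
  part : IsPartition n el pos blk fst sz nb
  mk_le : ∀ b < nb, mk b ≤ sz b
  mk_zero : ∀ b, nb ≤ b → mk b = 0
  marked : ∀ p < n, pos p < fst (blk p) + mk (blk p) ↔ p ∈ L
  sum_mk : ∑ b ∈ Finset.range nb, mk b = L.length

theorem sum_range_update_succ {f : ℕ → ℕ} {b m : ℕ} (hb : b < m) :
    ∑ i ∈ Finset.range m, Function.update f b (f b + 1) i = ∑ i ∈ Finset.range m, f i + 1 := by
  rw [Finset.sum_update_of_mem (Finset.mem_range.2 hb), ← Finset.sum_sdiff
    (Finset.singleton_subset_iff.2 (Finset.mem_range.2 hb)), Finset.sum_singleton]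
  omega

theorem sum_range_update_zero {f : ℕ → ℕ} {b m : ℕ} (hb : b < m) :
    ∑ i ∈ Finset.range m, Function.update f b 0 i + f b = ∑ i ∈ Finset.range m, f i := by
  rw [Finset.sum_update_of_mem (Finset.mem_range.2 hb), ← Finset.sum_sdiff
    (Finset.singleton_subset_iff.2 (Finset.mem_range.2 hb)), Finset.sum_singleton]
  omega

section
variable {n : ℕ} {el pos blk fst sz mk : ℕ → ℕ} {nb : ℕ} {L : List ℕ}

theorem IsPartition.isMarked_nil (h : IsPartition n el pos blk fst sz nb) (hmk : ∀ b, mk b = 0) :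
    IsMarked n el pos blk fst sz mk nb [] where
  part := h
  mk_le b _ := by rw [hmk]; omega
  mk_zero b _ := hmk b
  marked p hp := by
    have := h.mem p hp
    simp only [hmk, List.not_mem_nil, iff_false]
    omega
  sum_mk := by simp [hmk]

theorem IsMarked.mk_lt (h : IsMarked n el pos blk fst sz mk nb L) {p : ℕ} (hp : p < n)
    (hpL : p ∉ L) : mk (blk p) < sz (blk p) := by
  have h1 := h.part.mem p hp
  have h2 := mt (h.marked p hp).1 hpL
  omega

theorem IsMarked.mark (h : IsMarked n el pos blk fst sz mk nb L) {p y : ℕ} (hp : p < n)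
    (hpL : p ∉ L) (hy : y = fst (blk p) + mk (blk p)) :
    IsMarked n (Function.update (Function.update el (pos p) (el y)) y p)
      (Function.update (Function.update pos (el y) (pos p)) p y) blk fst sz
      (Function.update mk (blk p) (mk (blk p) + 1)) nb (L ++ [p]) := by
  have hlt := h.mk_lt hp hpL
  have hb := h.part.blk_lt p hp
  have hm := h.part.mem p hp
  have hpm := mt (h.marked p hp).1 hpL
  obtain ⟨hyn, hby⟩ := h.part.seg _ hb y (by omega) (by omega)
  refine ⟨h.part.swap hp (by omega) (by omega), fun b hb' => ?_, fun b hb' => ?_,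
    fun r hr => ?_, ?_⟩
  · have := h.mk_le b hb'
    rw [Function.update_apply]
    split_ifs with h1
    · subst h1; omega
    · exact this
  · rw [Function.update_of_ne (by omega), h.mk_zero b hb']
  · have hr' := h.marked r hr
    rw [List.mem_append, List.mem_singleton]
    by_cases h1 : r = p
    · subst h1
      simp only [Function.update_self, or_true, iff_true]
      omega
    · simp only [h1, or_false, Function.update_of_ne h1, ← hr']
      by_cases h2 : r = el y
      · subst h2
        have h3 := h.part.pos_el y hyn
        rw [Function.update_self, hby, Function.update_self, h3]
        have : pos p ≠ y := by
          intro h4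
          rw [← h4, h.part.el_pos p hp] at h1
          exact h1 rfl
        omega
      · rw [Function.update_of_ne h2]
        by_cases h3 : blk r = blk p
        · rw [h3, Function.update_self]
          have : pos r ≠ y := by
            rintro rfl
            exact h2 (h.part.el_pos r hr).symm
          omega
        · rw [Function.update_of_ne h3]
  · rw [sum_range_update_succ hb, h.sum_mk, List.length_append, List.length_singleton]

end

namespace RAM
open RAM.Expr

/-- Move each element of the list to the beginning of its block, behind those already moved. -/
def markList : Prog :=
  .write sI 0 0 ;; .write sTc 0 0 ;;
  .loop (lt (var sI) (var sCnt))
    (.write sP 0 (.read aList (var sI)) ;;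
     .write sB 0 (.read aBlk (var sP)) ;;
     .cond (.read aMk (var sB)) .skip
       (.write aTch (var sTc) (var sB) ;; .write sTc 0 (var sTc + 1)) ;;
     .write sX 0 (.read aPos (var sP)) ;;
     .write sY 0 (.read aFst (var sB) + .read aMk (var sB)) ;;
     .write sQ 0 (.read aEl (var sY)) ;;
     .write aEl (var sX) (var sQ) ;;
     .write aPos (var sQ) (var sX) ;;
     .write aEl (var sY) (var sP) ;;
     .write aPos (var sP) (var sY) ;;
     .write aMk (var sB) (.read aMk (var sB) + 1) ;;
     .write sI 0 (var sI + 1))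

theorem wp_markList {W n : ℕ} (hW : 2 * n + 2 < W) {M : Memory} {nb : ℕ} {L : List ℕ}
    (hpart : IsPartition n (M aEl) (M aPos) (M aBlk) (M aFst) (M aSz) nb)
    (hmk : ∀ b, M aMk b = 0) (hL : (List.range (M sCnt 0)).map (M aList) = L) (hnd : L.Nodup)
    (hLn : ∀ p ∈ L, p < n) :
    WP W markList M fun t M' => t ≤ 120 * L.length + 20 ∧
      IsMarked n (M' aEl) (M' aPos) (M aBlk) (M aFst) (M aSz) (M' aMk) nb L ∧
      Touched (M' aMk) (M' aTch) nb 0 (M' sTc 0) ∧ M' sTc 0 ≤ L.length ∧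
      Frame [aEl, aPos, aMk, aTch, sI, sTc, sP, sB, sX, sY, sQ] M M' := by
  have hlen : M sCnt 0 = L.length := by simp [← hL]
  have hLn' : L.length ≤ n := by
    have h1 : L ⊆ List.range n := fun p hp => List.mem_range.2 (hLn p hp)
    simpa using (hnd.subperm h1).length_le
  rw [markList]
  simp only [wp_seq, wp_write]
  simp
  repeat refine ⟨by omega, ?_⟩
  refine wp_loop_count L.length (fun i t M' => t ≤ 120 * i ∧ M' sI 0 = i ∧
    IsMarked n (M' aEl) (M' aPos) (M aBlk) (M aFst) (M aSz) (M' aMk) nb (L.take i) ∧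
      Touched (M' aMk) (M' aTch) nb 0 (M' sTc 0) ∧ M' sTc 0 ≤ i ∧
      Frame [aEl, aPos, aMk, aTch, sI, sTc, sP, sB, sX, sY, sQ] M M') ?_ ?_ ?_ ?_ ?_
  · refine ⟨by simp, by simp, by simpa using hpart.isMarked_nil hmk, ?_, by simp,
      (Frame.refl _ _).set.set⟩
    exact ⟨fun j _ h => by simp at h, fun j _ _ h => by simp at h, fun b hb => by simp [hmk] at hb⟩
  · rintro i t M' hi ⟨ht, hi', -, -, -, hf⟩
    simp [hi', hf.get sCnt, hlen]
    split_ifs <;> omega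
  · rintro i t M' hi ⟨ht, hi', -, -, -, hf⟩
    simp [hi', hf.get sCnt, hlen]
  · rintro i t M' hi ⟨ht, hi', hM, hT, hTc, hf⟩
    obtain ⟨p, hp⟩ : ∃ p, M aList i = p := ⟨_, rfl⟩
    have hpL : p = L[i] := by simp [← hp, ← hL]
    have hpn : p < n := hLn p (hpL ▸ List.getElem_mem hi)
    have hpt : p ∉ L.take i := by
      intro h
      obtain ⟨j, hj, hj'⟩ := List.getElem_of_mem h
      rw [List.getElem_take, hpL] at hj'
      have := (hnd.getElem_inj_iff).1 hj'
      rw [List.length_take] at hj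
      omega
    have htake : L.take (i + 1) = L.take i ++ [p] := by
      rw [List.take_add_one, List.getElem?_eq_getElem hi, hpL]; rfl
    obtain ⟨b, hb⟩ : ∃ b, M aBlk p = b := ⟨_, rfl⟩
    have hbn : b < nb := hb ▸ hM.part.blk_lt p hpn
    have hnb := hpart.nb_le
    have hmlt := hM.mk_lt hpn hpt
    have hseg := hM.part.seg_le (hM.part.blk_lt p hpn)
    have hpos := hM.part.pos_lt p hpn
    have hyn := hM.part.el_lt (M aFst b + M' aMk b) (by rw [hb] at hmlt hseg; omega)
    have hmark := hM.mark hpn hpt rfl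
    rw [hb] at hmlt hseg hmark
    rw [htake]
    by_cases hmb : M' aMk b = 0
    · have h1 : M aFst b < n := by omega
      rw [hmb, Nat.add_zero, Nat.zero_add] at hmark
      rw [hmb, Nat.add_zero] at hyn
      simp only [wp_seq, wp_write, wp_cond, wp_skip]
      simp [hi', hf.get aList, hp, hf.get aBlk, hb, hmb, hf.get aFst]
      repeat refine ⟨by omega, ?_⟩
      exact ⟨hT.push (by omega) hbn hmb (by omega), hTc,
        hf.set.set.set.set.set.set.set.set.set.set.set.set.set⟩
    · simp only [wp_seq, wp_write, wp_cond, wp_skip]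
      simp [hi', hf.get aList, hp, hf.get aBlk, hb, hmb, hf.get aFst]
      repeat refine ⟨by omega, ?_⟩
      exact ⟨hT.incr hmb (by omega), by omega, hf.set.set.set.set.set.set.set.set.set.set.set⟩
  · rintro t M' ⟨ht, -, hM, hT, hTc, hf⟩
    rw [List.take_length] at hM
    refine ⟨?_, hM, hT, hTc, hf⟩
    simp
    omega

end RAM

/-! ### Splitting blocks -/

/-- The state of the splitting phase, which started from the partition `blk₀` with the elements of
`L` marked. In the blocks `b` with `mk b ≠ 0` the marked elements occupy the first `mk b` places, and
these blocks have still to be split. All other blocks consist of marked or of unmarked elements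
only. A new block has at most half the size of the old one that it is a part of. -/
structure IsSplit (n : ℕ) (blk₀ sz₀ : ℕ → ℕ) (nb₀ : ℕ) (L : List ℕ)
    (el pos blk fst sz mk : ℕ → ℕ) (nb : ℕ) : Prop where
  part : IsPartition n el pos blk fst sz nb
  le_nb : nb₀ ≤ nb
  mk_le : ∀ b < nb, mk b ≤ sz b
  mk_zero : ∀ b, nb₀ ≤ b → mk b = 0
  old_or_new : ∀ p < n, blk p = blk₀ p ∨ nb₀ ≤ blk p
  refines : ∀ p < n, ∀ q < n, blk p = blk q → blk₀ p = blk₀ q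
  done : ∀ p < n, ∀ q < n, blk p = blk q → mk (blk p) = 0 → (p ∈ L ↔ q ∈ L)
  marked : ∀ p < n, mk (blk p) ≠ 0 → (pos p < fst (blk p) + mk (blk p) ↔ p ∈ L)
  coarse : ∀ p < n, ∀ q < n, blk₀ p = blk₀ q → (p ∈ L ↔ q ∈ L) → blk p = blk q
  sz_le : ∀ p < n, sz (blk p) ≤ sz₀ (blk₀ p)
  sz_half : ∀ p < n, blk p ≠ blk₀ p → 2 * sz (blk p) ≤ sz₀ (blk₀ p)

section
variable {n : ℕ} {blk₀ sz₀ : ℕ → ℕ} {nb₀ : ℕ} {L : List ℕ}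
  {el pos blk fst sz mk : ℕ → ℕ} {nb : ℕ}

theorem IsMarked.isSplit (h : IsMarked n el pos blk fst sz mk nb L) :
    IsSplit n blk sz nb L el pos blk fst sz mk nb where
  part := h.part
  le_nb := le_rfl
  mk_le := h.mk_le
  mk_zero := h.mk_zero
  old_or_new _ _ := Or.inl rfl
  refines _ _ _ _ h := h
  done p hp q hq h1 h2 := by
    have h3 := h.marked p hp
    have h4 := h.marked q hq
    have h5 := h.part.mem p hp
    have h6 := h.part.mem q hq
    rw [← h1] at h4 h6
    rw [h2] at h3 h4
    rw [← h3, ← h4]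
    omega
  marked p hp _ := h.marked p hp
  coarse _ _ _ _ h _ := h
  sz_le _ _ := le_rfl
  sz_half _ _ h := absurd rfl h

/-- A block all of whose elements are marked stays as it is. -/
theorem IsSplit.keep (h : IsSplit n blk₀ sz₀ nb₀ L el pos blk fst sz mk nb) {b : ℕ}
    (hm0 : mk b ≠ 0) (hm : mk b = sz b) :
    IsSplit n blk₀ sz₀ nb₀ L el pos blk fst sz (Function.update mk b 0) nb where
  part := h.part
  le_nb := h.le_nb
  mk_le b' hb' := by
    have := h.mk_le b' hb'
    rw [Function.update_apply]
    split_ifs <;> omega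
  mk_zero b' hb' := by
    have := h.mk_zero b' hb'
    rw [Function.update_apply]
    split_ifs <;> omega
  old_or_new := h.old_or_new
  refines := h.refines
  done p hp q hq h1 h2 := by
    by_cases h3 : blk p = b
    · have h4 := h.marked p hp (by rwa [h3])
      have h5 := h.marked q hq (by rwa [← h1, h3])
      have h6 := h.part.mem p hp
      have h7 := h.part.mem q hq
      rw [← h1, h3] at h5 h7
      rw [h3] at h4 h6
      rw [← h4, ← h5]
      omega
    · rw [Function.update_of_ne h3] at h2
      exact h.done p hp q hq h1 h2
  marked p hp h1 := by
    by_cases h3 : blk p = b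
    · rw [h3, Function.update_self] at h1
      exact absurd rfl h1
    · rw [Function.update_of_ne h3] at h1 ⊢
      exact h.marked p hp h1
  coarse := h.coarse
  sz_le := h.sz_le
  sz_half := h.sz_half

/-- A block with marked and unmarked elements is split. The smaller part becomes the new block. -/
theorem IsSplit.split (h : IsSplit n blk₀ sz₀ nb₀ L el pos blk fst sz mk nb)
    {b lo len f : ℕ} (hb : b < nb₀) (hm0 : mk b ≠ 0) (hm : mk b < sz b) (hlen : 2 * len ≤ sz b)
    (hlo : lo = fst b ∧ len = mk b ∧ f = fst b + mk b ∨
      lo = fst b + mk b ∧ len = sz b - mk b ∧ f = fst b) {blk' : ℕ → ℕ}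
    (hblk : ∀ p < n, blk' p = if lo ≤ pos p ∧ pos p < lo + len then nb else blk p) :
    IsSplit n blk₀ sz₀ nb₀ L el pos blk'
      (Function.update (Function.update fst b f) nb lo)
      (Function.update (Function.update sz b (sz b - len)) nb len)
      (Function.update mk b 0) (nb + 1) := by
  have hbnb : b < nb := hb.trans_le h.le_nb
  have hin : ∀ p < n, lo ≤ pos p → pos p < lo + len → blk p = b := by
    intro p hp h1 h2
    have := (h.part.seg b hbnb (pos p) (by omega) (by omega)).2
    rwa [h.part.el_pos p hp] at this
  have hnb : ∀ p < n, blk p ≠ nb := fun p hp => (h.part.blk_lt p hp).ne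
  -- The marked and the unmarked elements of the block `b` are told apart by the segment.
  have hside : ∀ p < n, ∀ q < n, blk p = b → blk q = b →
      ((p ∈ L ↔ q ∈ L) ↔
        (lo ≤ pos p ∧ pos p < lo + len ↔ lo ≤ pos q ∧ pos q < lo + len)) := by
    intro p hp q hq h1 h2
    have h3 := h.marked p hp (by rwa [h1])
    have h4 := h.marked q hq (by rwa [h2])
    have h5 := h.part.mem p hp
    have h6 := h.part.mem q hq
    rw [h1] at h3 h5
    rw [h2] at h4 h6
    rw [← h3, ← h4]
    omega
  have hcases : ∀ p < n, (blk' p = nb ∧ blk p = b ∧ (lo ≤ pos p ∧ pos p < lo + len)) ∨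
      (blk' p = blk p ∧ ¬(lo ≤ pos p ∧ pos p < lo + len)) := by
    intro p hp
    rw [hblk p hp]
    split_ifs with h1
    · exact Or.inl ⟨rfl, hin p hp h1.1 h1.2, h1⟩
    · exact Or.inr ⟨rfl, h1⟩
  have hrefines : ∀ p < n, ∀ q < n, blk' p = blk' q → blk p = blk q := by
    intro p hp q hq h1
    have := hnb p hp
    have := hnb q hq
    rcases hcases p hp with h2 | h2 <;> rcases hcases q hq with h3 | h3 <;> omega
  have hsz : ∀ p < n, Function.update (Function.update sz b (sz b - len)) nb len (blk' p) ≤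
      sz (blk p) ∧ (blk' p ≠ blk p →
        2 * Function.update (Function.update sz b (sz b - len)) nb len (blk' p) ≤ sz (blk p)) := by
    intro p hp
    have h1 := hnb p hp
    rcases hcases p hp with ⟨h2, h3, -⟩ | ⟨h2, -⟩
    · rw [h2, Function.update_self, h3]
      exact ⟨by omega, fun _ => hlen⟩
    · rw [h2, Function.update_of_ne h1]
      refine ⟨?_, fun h => absurd rfl h⟩
      rw [Function.update_apply]
      split_ifs with h3
      · rw [h3]; omega
      · exact le_rfl
  refine ⟨h.part.split hbnb (by omega) (by omega) (by omega) hblk, by have := h.le_nb; omega,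
    ?_, ?_, ?_, ?_, ?_, ?_, ?_, ?_, ?_⟩
  · intro b' hb'
    have h1 := h.mk_zero nb h.le_nb
    by_cases h2 : b' = b
    · rw [h2, Function.update_self]; omega
    · by_cases h3 : b' = nb
      · rw [Function.update_of_ne h2, h3, h1]; omega
      · rw [Function.update_of_ne h2, Function.update_of_ne h3, Function.update_of_ne h2]
        exact h.mk_le b' (by omega)
  · intro b' hb'
    rw [Function.update_of_ne (by omega), h.mk_zero b' hb']
  · intro p hp
    have := h.old_or_new p hp
    have := h.le_nb
    rcases hcases p hp with h1 | h1 <;> omega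
  · exact fun p hp q hq h1 => h.refines p hp q hq (hrefines p hp q hq h1)
  · intro p hp q hq h1 h2
    have h3 := hrefines p hp q hq h1
    by_cases h4 : blk p = b
    · rw [hside p hp q hq h4 (h3 ▸ h4)]
      have := hnb p hp
      have := hnb q hq
      rcases hcases p hp with h5 | h5 <;> rcases hcases q hq with h6 | h6 <;> omega
    · refine h.done p hp q hq h3 ?_
      rcases hcases p hp with h5 | h5
      · exact absurd h5.2.1 h4
      · rwa [h5.1, Function.update_of_ne h4] at h2
  · intro p hp h1
    have h0 := h.mk_zero nb h.le_nb
    rcases hcases p hp with h5 | h5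
    · rw [h5.1, Function.update_of_ne (by omega), h0] at h1
      exact absurd rfl h1
    · rw [h5.1] at h1 ⊢
      by_cases h4 : blk p = b
      · rw [h4, Function.update_self] at h1
        exact absurd rfl h1
      · rw [Function.update_of_ne h4] at h1
        rw [Function.update_of_ne (hnb p hp), Function.update_of_ne h4, Function.update_of_ne h4]
        exact h.marked p hp h1
  · intro p hp q hq h1 h2
    have h3 := h.coarse p hp q hq h1 h2
    by_cases h4 : blk p = b
    · rw [hside p hp q hq h4 (h3 ▸ h4)] at h2
      rcases hcases p hp with h5 | h5 <;> rcases hcases q hq with h6 | h6 <;> omega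
    · rcases hcases p hp with h5 | h5 <;> rcases hcases q hq with h6 | h6 <;> omega
  · exact fun p hp => (hsz p hp).1.trans (h.sz_le p hp)
  · intro p hp h1
    by_cases h2 : blk' p = blk p
    · rw [h2] at h1
      have := h.sz_half p hp h1
      have := (hsz p hp).1
      omega
    · have := (hsz p hp).2 h2
      have := h.sz_le p hp
      omega

end

namespace RAM
open RAM.Expr

/-- Give the elements listed from `sJ` to `sEnd` the block number `sNb`. -/
def relabelSegment : Prog :=
  .loop (lt (var sJ) (var sEnd))
    (.write aBlk (.read aEl (var sJ)) (var sNb) ;; .write sJ 0 (var sJ + 1))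

theorem wp_relabelSegment {W n : ℕ} (hW : n + 1 < W) {M : Memory} {pos blk fst sz : ℕ → ℕ}
    {nb lo len : ℕ} (hpart : IsPartition n (M aEl) pos blk fst sz nb) (hJ : M sJ 0 = lo)
    (hEnd : M sEnd 0 = lo + len) (hlo : lo + len ≤ n) (hnb : M sNb 0 ≤ n) :
    WP W relabelSegment M fun t M' => t ≤ 25 * len + 10 ∧
      (∀ p < n, M' aBlk p = if lo ≤ pos p ∧ pos p < lo + len then M sNb 0 else M aBlk p) ∧
      Frame [aBlk, sJ] M M' := by
  rw [relabelSegment]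
  refine wp_loop_count len (fun i t M' => t ≤ 25 * i ∧ M' sJ 0 = lo + i ∧
    (∀ p < n, M' aBlk p = if lo ≤ pos p ∧ pos p < lo + i then M sNb 0 else M aBlk p) ∧
      Frame [aBlk, sJ] M M') ?_ ?_ ?_ ?_ ?_
  · exact ⟨by simp, by simp [hJ], fun p _ => by rw [if_neg (by omega)], Frame.refl _ _⟩
  · rintro i t M' hi ⟨ht, hj, hb, hf⟩
    simp [hj, hf.get sEnd, hEnd]
    split_ifs <;> omega
  · rintro i t M' hi ⟨ht, hj, hb, hf⟩
    simp [hj, hf.get sEnd, hEnd]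
  · rintro i t M' hi ⟨ht, hj, hb, hf⟩
    have hel := hpart.el_lt (lo + i) (by omega)
    simp only [wp_seq, wp_write]
    simp [hj, hf.get sNb, hf.get aEl]
    repeat refine ⟨by omega, ?_⟩
    refine ⟨fun p hp => ?_, hf.set.set⟩
    by_cases h : p = M aEl (lo + i)
    · rw [h, Function.update_self, hpart.pos_el _ (by omega), if_pos (by omega)]
    · have : pos p ≠ lo + i := fun h' => h (by rw [← h', hpart.el_pos p hp])
      rw [Function.update_of_ne h, hb p hp]
      congr 1
      simp only [eq_iff_iff]
      omega
  · rintro t M' ⟨ht, hj, hb, hf⟩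
    refine ⟨?_, hb, hf⟩
    simp
    omega

/-- Split the block `sB`, whose first `sM` elements are marked: the smaller part becomes the block
`sNb`. -/
def splitBlock : Prog :=
  .cond (lt (.read aSz (var sB) - var sM) (var sM))
    (.write sJ 0 (.read aFst (var sB) + var sM) ;;
     .write sLen 0 (.read aSz (var sB) - var sM))
    (.write sJ 0 (.read aFst (var sB)) ;;
     .write sLen 0 (var sM) ;;
     .write aFst (var sB) (.read aFst (var sB) + var sM)) ;;
  .write aSz (var sB) (.read aSz (var sB) - var sLen) ;;
  .write aFst (var sNb) (var sJ) ;;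
  .write aSz (var sNb) (var sLen) ;;
  .write sEnd 0 (var sJ + var sLen) ;;
  relabelSegment ;;
  .write sNb 0 (var sNb + 1)

theorem wp_splitBlock {W n : ℕ} (hW : 2 * n + 2 < W) {M : Memory} {pos : ℕ → ℕ} {nb b m : ℕ}
    (hpart : IsPartition n (M aEl) pos (M aBlk) (M aFst) (M aSz) nb) (hb : b < nb)
    (hsB : M sB 0 = b) (hsM : M sM 0 = m) (hsNb : M sNb 0 = nb)
    (hm : m < M aSz b) :
    WP W splitBlock M fun t M' => t ≤ 25 * m + 100 ∧
      (∃ lo len f, 2 * len ≤ M aSz b ∧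
        (lo = M aFst b ∧ len = m ∧ f = M aFst b + m ∨
          lo = M aFst b + m ∧ len = M aSz b - m ∧ f = M aFst b) ∧
        (∀ p < n, M' aBlk p = if lo ≤ pos p ∧ pos p < lo + len then nb else M aBlk p) ∧
        M' aFst = Function.update (Function.update (M aFst) b f) nb lo ∧
        M' aSz = Function.update (Function.update (M aSz) b (M aSz b - len)) nb len) ∧
      M' sNb 0 = nb + 1 ∧ Frame [aBlk, aFst, aSz, sJ, sLen, sEnd, sNb] M M' := by
  have hseg := hpart.seg_le hb
  have hnb := hpart.nb_le
  rw [splitBlock, wp_seq, wp_cond]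
  refine ⟨by simp [hsB, hsM]; split_ifs <;> omega, fun h => ?_, fun h => ?_⟩
  · simp [hsB, hsM] at h
    simp only [wp_seq, wp_write]
    simp [hsB, hsM, hsNb]
    repeat refine ⟨by omega, ?_⟩
    refine (wp_relabelSegment (n := n) (W := W) (by omega) (by simpa using hpart) (by simp; rfl)
      (by simp; rfl) (by omega) (by simp; omega)).mono ?_
    rintro t M' ⟨ht, hblk, hf⟩
    simp [hsNb] at hblk
    simp [hf.get sNb, hsNb, hf.get aFst, hf.get aSz]
    repeat refine ⟨by omega, ?_⟩
    refine ⟨⟨M aFst b + m, M aSz b - m, by omega, M aFst b, by simp, hblk, by simp, rfl⟩, ?_⟩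
    exact (Frame.trans (Frame.refl _ M).set.set.set.set.set.set hf).set
  · simp [hsB, hsM] at h
    simp only [wp_seq, wp_write]
    simp [hsB, hsM, hsNb]
    repeat refine ⟨by omega, ?_⟩
    refine (wp_relabelSegment (n := n) (W := W) (by omega) (by simpa using hpart) (by simp; rfl)
      (by simp; rfl) (by omega) (by simp; omega)).mono ?_
    rintro t M' ⟨ht, hblk, hf⟩
    simp [hsNb] at hblk
    simp [hf.get sNb, hsNb, hf.get aFst, hf.get aSz]
    repeat refine ⟨by omega, ?_⟩
    refine ⟨⟨M aFst b, m, by omega, M aFst b + m, by simp, hblk, by simp, rfl⟩, ?_⟩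
    exact (Frame.trans (Frame.refl _ M).set.set.set.set.set.set.set hf).set

/-- Split all blocks that contain both marked and unmarked elements. -/
def splitTouched : Prog :=
  .write sI 0 0 ;;
  .loop (lt (var sI) (var sTc))
    (.write sB 0 (.read aTch (var sI)) ;;
     .write sM 0 (.read aMk (var sB)) ;;
     .write aMk (var sB) 0 ;;
     .cond (lt (var sM) (.read aSz (var sB))) splitBlock .skip ;;
     .write sI 0 (var sI + 1))

theorem wp_splitTouched {W n : ℕ} (hW : 2 * n + 2 < W) {M : Memory} {nb : ℕ} {L : List ℕ}
    (hmarked : IsMarked n (M aEl) (M aPos) (M aBlk) (M aFst) (M aSz) (M aMk) nb L)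
    (htouched : Touched (M aMk) (M aTch) nb 0 (M sTc 0)) (htc : M sTc 0 ≤ n) (hnb : M sNb 0 = nb) :
    WP W splitTouched M fun t M' => t ≤ 200 * L.length + 10 ∧
      IsSplit n (M aBlk) (M aSz) nb L (M' aEl) (M' aPos) (M' aBlk) (M' aFst) (M' aSz) (M' aMk)
        (M' sNb 0) ∧
      (∀ b, M' aMk b = 0) ∧
      Frame [aBlk, aFst, aSz, aMk, sI, sB, sM, sJ, sLen, sEnd, sNb] M M' := by
  rw [splitTouched, wp_seq, wp_write]
  refine ⟨by simp; omega, by simp; omega, ?_⟩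
  -- The time for a block is paid for by the number of its marked elements, which is reset to `0`.
  refine wp_loop_count (M sTc 0) (fun i t M' =>
    t + 200 * ∑ b ∈ Finset.range nb, M' aMk b ≤ 200 * L.length ∧ M' sI 0 = i ∧
      IsSplit n (M aBlk) (M aSz) nb L (M' aEl) (M' aPos) (M' aBlk) (M' aFst) (M' aSz) (M' aMk)
        (M' sNb 0) ∧
      Touched (M' aMk) (M aTch) nb i (M sTc 0) ∧
      Frame [aBlk, aFst, aSz, aMk, sI, sB, sM, sJ, sLen, sEnd, sNb] M M') ?_ ?_ ?_ ?_ ?_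
  · refine ⟨by simp [hmarked.sum_mk], by simp, ?_, ?_, (Frame.refl _ _).set⟩
    · simpa [hnb] using hmarked.isSplit
    · simpa using htouched
  · rintro i t M' hi ⟨ht, hi', -, -, hf⟩
    simp [hi', hf.get sTc]
    split_ifs <;> omega
  · rintro i t M' hi ⟨ht, hi', -, -, hf⟩
    simp [hi', hf.get sTc]
  · rintro i t M' hi ⟨ht, hi', hS, hT, hf⟩
    obtain ⟨hb, hm0⟩ := hT.lt i le_rfl hi
    have hpop := hT.pop hi
    obtain ⟨b, hb'⟩ : ∃ b, M aTch i = b := ⟨_, rfl⟩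
    rw [hb'] at hb hm0 hpop
    have hsum := sum_range_update_zero (f := M' aMk) hb
    have hnbn := hS.part.nb_le
    have hle := hS.le_nb
    have hmle := hS.mk_le b (by omega)
    have hseg := hS.part.seg_le (b := b) (by omega)
    simp only [wp_seq, wp_write, wp_cond, wp_skip]
    simp [hi', hf.get aTch, hb']
    repeat refine ⟨by omega, ?_⟩
    refine ⟨by split_ifs <;> omega, fun h => ?_, fun h => ?_⟩
    · refine (wp_splitBlock (n := n) (nb := M' sNb 0) (b := b) (m := M' aMk b) (pos := M' aPos) hW
        (by simpa using hS.part) (by omega) (by simp) (by simp) (by simp)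
        (by simpa using h)).mono ?_
      rintro t' M'' ⟨ht', ⟨lo, len, f, h1, h2, h3, h4, h5⟩, h6, hf'⟩
      simp at h1 h2 h3 h4 h5
      simp [hf'.get sI, hi', hf'.get aEl, hf'.get aPos, hf'.get aMk, h4, h5, h6]
      repeat refine ⟨by omega, ?_⟩
      exact ⟨hS.split hb hm0 h h1 h2 h3, hpop,
        (Frame.trans hf.set.set.set hf').set⟩
    · repeat refine ⟨by omega, ?_⟩
      exact ⟨hS.keep hm0 (by omega), hpop, hf.set.set.set.set⟩
  · rintro t M' ⟨ht, -, hS, hT, hf⟩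
    refine ⟨?_, hS, fun b => ?_, hf⟩
    · simp
      omega
    · by_contra h
      obtain ⟨j, h1, h2, -⟩ := hT.surj b h
      omega

end RAM

/-! ### Partition refinement -/

/-- The invariant of the partition refinement: the partition is not finer than inseparability, and
whenever two states of a block are told apart by the blocks of their successors under a letter, then
one of the pairs of such a block and this letter has still to be processed. The pair of the
block `b` and the letter `a` has the number `b * k + a`, and the pairs from `c` on are those that
have still to be processed. -/
structure IsRefining {n k : ℕ} (A : PartialAutomaton (Fin n) (Fin k)) (blk : ℕ → ℕ) (c : ℕ) :
    Prop where
  of_insep : ∀ p q : Fin n, A.insep.r p q → blk p = blk q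
  stable : ∀ p q : Fin n, blk p = blk q → ∀ a,
    ((A.δ p a).map fun u : Fin n => blk u) = ((A.δ q a).map fun u : Fin n => blk u) ∨
    (∃ u, A.δ p a = some u ∧ c ≤ blk u * k + a) ∨ (∃ v, A.δ q a = some v ∧ c ≤ blk v * k + a)

section
variable {n k : ℕ} {A : PartialAutomaton (Fin n) (Fin k)} {blk sz : ℕ → ℕ} {nb c : ℕ}
  {L : List ℕ} {el' pos' blk' fst' sz' mk' : ℕ → ℕ} {nb' : ℕ}

theorem IsRefining.step (h : IsRefining A blk c)
    (hS : IsSplit n blk sz nb L el' pos' blk' fst' sz' mk' nb') (hmk : ∀ b, mk' b = 0)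
    (hc : c < nb * k) (a : Fin k) (ha : c % k = a)
    (hL : ∀ p : Fin n, p.val ∈ L ↔ ∃ u, A.δ p a = some u ∧ blk u = c / k) :
    IsRefining A blk' (c + 1) := by
  have hdiv := Nat.div_add_mod' c k
  have hfresh : ∀ (u : Fin n) (a' : Fin k), blk' u ≠ blk u → c + 1 ≤ blk' u * k + a' := by
    intro u a' hu
    have h1 := (hS.old_or_new u u.2).resolve_left hu
    have := Nat.mul_le_mul_right k h1
    omega
  have hkeep : ∀ (u : Fin n) (a' : Fin k), c ≤ blk u * k + a' →
      c + 1 ≤ blk' u * k + a' ∨ (blk u = c / k ∧ a' = a) := by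
    intro u a' hu
    by_cases h1 : blk' u = blk u
    · rw [h1]
      by_cases h2 : c = blk u * k + a'
      · right
        obtain ⟨h3, h4⟩ := mul_add_inj a'.2 a.2
          (show blk u * k + a' = c / k * k + a by rw [← h2, ← ha, hdiv])
        exact ⟨h3, Fin.ext h4⟩
      · left; omega
    · exact Or.inl (hfresh u a' h1)
  refine ⟨fun p q hpq => ?_, fun p q hpq a' => ?_⟩
  · refine hS.coarse p p.2 q q.2 (h.of_insep p q hpq) ?_
    have h1 := A.insep_step a p q hpq
    rw [hL, hL]
    cases hp : A.δ p a <;> cases hq : A.δ q a <;> simp only [hp, hq, Option.map_none,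
      Option.map_some, reduceCtorEq, Option.some.injEq] at h1
    · simp
    · have := h.of_insep _ _ (Quotient.exact h1)
      simp [this]
  · have h1 := hS.refines p p.2 q q.2 hpq
    have h2 := hS.done p p.2 q q.2 hpq (hmk _)
    rw [hL, hL] at h2
    have h3 := h.stable p q h1 a'
    cases hp : A.δ p a' with
    | none =>
      cases hq : A.δ q a' with
      | none => exact Or.inl rfl
      | some v =>
        simp only [hp, hq, Option.map_none, Option.map_some, reduceCtorEq, false_and, exists_false,
          false_or, Option.some.injEq, exists_eq_left'] at h3 ⊢
        rcases hkeep v a' h3 with h4 | ⟨h4, rfl⟩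
        · exact h4
        · simp [hp, hq, h4] at h2
    | some u =>
      cases hq : A.δ q a' with
      | none =>
        simp only [hp, hq, Option.map_none, Option.map_some, reduceCtorEq, false_and, exists_false,
          false_or, or_false, Option.some.injEq, exists_eq_left'] at h3 ⊢
        rcases hkeep u a' h3 with h4 | ⟨h4, rfl⟩
        · exact h4
        · simp [hp, hq, h4] at h2
      | some v =>
        simp only [hp, hq, Option.map_some, Option.some.injEq, exists_eq_left'] at h3 ⊢
        have heq : blk u = blk v →
            blk' u = blk' v ∨ c + 1 ≤ blk' u * k + a' ∨ c + 1 ≤ blk' v * k + a' := by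
          intro h4
          by_cases h5 : blk' u = blk u
          · by_cases h6 : blk' v = blk v
            · exact Or.inl (by omega)
            · exact Or.inr (Or.inr (hfresh v a' h6))
          · exact Or.inr (Or.inl (hfresh u a' h5))
        rcases h3 with h3 | h3 | h3
        · exact heq h3
        · rcases hkeep u a' h3 with h4 | ⟨h4, rfl⟩
          · exact Or.inr (Or.inl h4)
          · simp [hp, hq, h4] at h2
            exact heq (by omega)
        · rcases hkeep v a' h3 with h4 | ⟨h4, rfl⟩
          · exact Or.inr (Or.inr h4)
          · simp [hp, hq, h4] at h2
            exact heq (by omega)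

/-- When all pairs have been processed, the partition is the one into inseparability classes. -/
theorem IsRefining.blk_eq_iff (h : IsRefining A blk c) (hblk : ∀ p < n, blk p < nb)
    (hc : nb * k ≤ c) (p q : Fin n) : blk p = blk q ↔ A.insep.r p q := by
  refine ⟨fun hpq => A.insep_of_congruence (fun p : Fin n => blk p) (fun p q hpq a => ?_) hpq,
    h.of_insep p q⟩
  have hlt : ∀ u : Fin n, ¬c ≤ blk u * k + a := fun u hu => by
    have := mul_add_lt_mul (hblk u u.2) a.2
    omega
  rcases h.stable p q hpq a with h1 | ⟨u, -, h1⟩ | ⟨u, -, h1⟩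
  · exact h1
  · exact absurd h1 (hlt u)
  · exact absurd h1 (hlt u)

end

/-- How often, at most, the pair of the block of the state `x / k` and the letter `x % k` will still
be processed: when it has been processed, it has to be processed again only after the block
of `x / k` has been replaced by a block of at most half the size. -/
def level (blk sz : ℕ → ℕ) (k c x : ℕ) : ℕ :=
  Nat.log 2 (sz (blk (x / k))) + if c ≤ blk (x / k) * k + x % k then 1 else 0

/-- An upper bound, up to a constant factor, for the remaining time of the partition refinement. -/
def potential (tb blk sz : ℕ → ℕ) (n k c : ℕ) : ℕ :=
  ∑ x ∈ Finset.range (n * k), ((inEdges tb k x (n * k)).length + 1) * level blk sz k c x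

theorem potential_init_le (tb : ℕ → ℕ) {blk sz : ℕ → ℕ} {n k : ℕ} (hblk : ∀ p, blk p = 0)
    (hsz : sz 0 = n) : potential tb blk sz n k 0 ≤ 2 * (n * k) * (Nat.log 2 n + 1) := by
  simp only [potential, level, hblk, hsz, Nat.zero_le, if_true]
  rw [← Finset.sum_mul, Finset.sum_add_distrib]
  have := sum_length_inEdges_le tb k (n * k) (n * k)
  refine Nat.mul_le_mul_right _ ?_
  simp
  omega

section
variable {n k : ℕ} {el pos blk fst sz : ℕ → ℕ} {nb c : ℕ}
  {L : List ℕ} {el' pos' blk' fst' sz' mk' : ℕ → ℕ} {nb' : ℕ}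

theorem level_step_le (hS : IsSplit n blk sz nb L el' pos' blk' fst' sz' mk' nb') {x : ℕ} (hx : x < n * k) :
    level blk' sz' k (c + 1) x + (if blk (x / k) * k + x % k = c then 1 else 0) ≤
      level blk sz k c x := by
  have hp : x / k < n := Nat.div_lt_of_lt_mul (by rwa [Nat.mul_comm])
  simp only [level]
  by_cases h1 : blk' (x / k) = blk (x / k)
  · have h2 := Nat.log_mono_right (b := 2) (hS.sz_le _ hp)
    rw [h1] at h2 ⊢
    split_ifs <;> omega
  · have h2 := hS.sz_half _ hp h1
    have h3 := hS.part.sz_pos _ (hS.part.blk_lt _ hp)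
    have h4 : Nat.log 2 (sz' (blk' (x / k))) + 1 ≤ Nat.log 2 (sz (blk (x / k))) := by
      rw [← Nat.log_mul_base (by norm_num) (by omega), Nat.mul_comm]
      exact Nat.log_mono_right h2
    split_ifs <;> omega

/-- The work for a pair of a block and a letter is paid for by a decrease of the potential. -/
theorem potential_step_le (tb : ℕ → ℕ) (hpart : IsPartition n el pos blk fst sz nb)
    (hS : IsSplit n blk sz nb L el' pos' blk' fst' sz' mk' nb') (hc : c < nb * k) :
    potential tb blk' sz' n k (c + 1) + sz (c / k) +
      (predList tb el n k (c % k) (fst (c / k)) (sz (c / k))).length ≤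
      potential tb blk sz n k c := by
  have hk : 0 < k := Nat.pos_of_ne_zero (by rintro rfl; simp at hc)
  have ha : c % k < k := Nat.mod_lt _ hk
  have hb : c / k < nb := Nat.div_lt_of_lt_mul (by rwa [Nat.mul_comm])
  have hseg := hpart.seg_le hb
  have hw : sz (c / k) + (predList tb el n k (c % k) (fst (c / k)) (sz (c / k))).length ≤
      ∑ x ∈ Finset.range (n * k), ((inEdges tb k x (n * k)).length + 1) *
        (if blk (x / k) * k + x % k = c then 1 else 0) := by
    rw [length_predList]
    calc _ = ∑ j ∈ Finset.range (sz (c / k)),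
          ((inEdges tb k (el (fst (c / k) + j) * k + c % k) (n * k)).length + 1) := by
          rw [Finset.sum_add_distrib]; simp; omega
      _ = ∑ x ∈ (Finset.range (sz (c / k))).image fun j => el (fst (c / k) + j) * k + c % k,
          ((inEdges tb k x (n * k)).length + 1) := by
          rw [Finset.sum_image]
          intro i hi j hj hij
          simp only [Finset.coe_range, Set.mem_Iio] at hi hj
          have h1 := (mul_add_inj ha ha hij).1
          have h2 := hpart.pos_el (fst (c / k) + i) (by omega)
          have h3 := hpart.pos_el (fst (c / k) + j) (by omega)
          rw [h1] at h2
          omega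
      _ ≤ ∑ x ∈ (Finset.range (n * k)).filter fun x => blk (x / k) * k + x % k = c,
          ((inEdges tb k x (n * k)).length + 1) := by
          refine Finset.sum_le_sum_of_subset fun x hx => ?_
          obtain ⟨j, hj, rfl⟩ := Finset.mem_image.1 hx
          rw [Finset.mem_range] at hj
          obtain ⟨h1, h2⟩ := hpart.seg _ hb (fst (c / k) + j) (by omega) (by omega)
          rw [Finset.mem_filter, Finset.mem_range]
          refine ⟨mul_add_lt_mul (hpart.el_lt _ h1) ha, ?_⟩
          rw [mul_add_div_of_lt _ ha, mul_add_mod_self_of_lt _ ha, h2]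
          exact Nat.div_add_mod' c k
      _ = _ := by simp [Finset.sum_filter]
  have hsum : potential tb blk' sz' n k (c + 1) +
      ∑ x ∈ Finset.range (n * k), ((inEdges tb k x (n * k)).length + 1) *
        (if blk (x / k) * k + x % k = c then 1 else 0) ≤ potential tb blk sz n k c := by
    rw [potential, potential, ← Finset.sum_add_distrib]
    refine Finset.sum_le_sum fun x hx => ?_
    rw [← Nat.mul_add]
    exact Nat.mul_le_mul_left _ (level_step_le hS (Finset.mem_range.1 hx))
  omega

end

namespace RAM
open RAM.Expr

/-- Refine the partition with respect to the pair of a block and a letter with number `sC`. -/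
def refineStep : Prog :=
  .write sB 0 (var sC / eK) ;;
  .write sA 0 (var sC % eK) ;;
  collectPreds ;; markList ;; splitTouched ;;
  .write sC 0 (var sC + 1)

theorem wp_refineStep {W n k : ℕ} (hW : 4 * (n * k + n + k + 1) < W) {M : Memory}
    {tb : ℕ → ℕ} {nb c : ℕ} (hk : M 0 1 = k)
    (hch : ∀ x, Chain (M aNext) (M aHead x) (inEdges tb k x (n * k)))
    (hpart : IsPartition n (M aEl) (M aPos) (M aBlk) (M aFst) (M aSz) nb)
    (hmk : ∀ b, M aMk b = 0) (hnb : M sNb 0 = nb) (hC : M sC 0 = c) (hc : c < nb * k) :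
    WP W refineStep M fun t M' => ∃ L,
      L = predList tb (M aEl) n k (c % k) (M aFst (c / k)) (M aSz (c / k)) ∧
      t ≤ 60 * M aSz (c / k) + 360 * L.length + 100 ∧
      IsSplit n (M aBlk) (M aSz) nb L (M' aEl) (M' aPos) (M' aBlk) (M' aFst) (M' aSz) (M' aMk)
        (M' sNb 0) ∧
      (∀ b, M' aMk b = 0) ∧ M' sC 0 = c + 1 ∧
      Frame [aEl, aPos, aBlk, aFst, aSz, aMk, aList, aTch, sI, sX, sC, sNb, sCnt, sTc, sB, sJ, sEnd,
        sE, sP, sY, sQ, sM, sLen, sA] M M' := by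
  have hk0 : 0 < k := Nat.pos_of_ne_zero (by rintro rfl; simp at hc)
  have ha : c % k < k := Nat.mod_lt _ hk0
  have hb : c / k < nb := Nat.div_lt_of_lt_mul (by rwa [Nat.mul_comm])
  have hnbn := hpart.nb_le
  have hcn : c < n * k := hc.trans_le (Nat.mul_le_mul_right k hnbn)
  rw [refineStep]
  simp only [wp_seq, wp_write]
  simp [hC, hk]
  repeat refine ⟨by omega, ?_⟩
  refine (wp_collectPreds (n := n) (k := k) (nb := nb) (a := c % k) (b := c / k) (pos := M aPos)
    (blk := M aBlk) (tb := tb) hW (by simpa using hk) (by simpa using hch) (by simpa using hpart) hb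
    ha (by simp) (by simp)).mono ?_
  rintro t₁ M₁ ⟨ht₁, hcnt, hlist, hf₁⟩
  obtain ⟨L, hL⟩ : ∃ L, predList tb (M aEl) n k (c % k) (M aFst (c / k)) (M aSz (c / k)) = L :=
    ⟨_, rfl⟩
  simp [hL] at ht₁ hcnt hlist
  have hel : ∀ i < M aSz (c / k), ∀ j < M aSz (c / k),
      M aEl (M aFst (c / k) + i) = M aEl (M aFst (c / k) + j) → i = j := by
    intro i hi j hj hij
    have := hpart.seg_le hb
    have h1 := hpart.pos_el (M aFst (c / k) + i) (by omega)
    have h2 := hpart.pos_el (M aFst (c / k) + j) (by omega)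
    rw [hij] at h1
    omega
  have hf₁' := Frame.trans (l := [aEl, aPos, aBlk, aFst, aSz, aMk, aList, aTch, sI, sX, sC, sNb,
    sCnt, sTc, sB, sJ, sEnd, sE, sP, sY, sQ, sM, sLen, sA]) (Frame.refl _ M).set.set hf₁
  refine (wp_markList (n := n) (nb := nb) (L := L) (by omega) ?_ ?_ hlist ?_ ?_).mono ?_
  · simpa [hf₁.get aEl, hf₁.get aPos, hf₁.get aBlk, hf₁.get aFst, hf₁.get aSz] using hpart
  · simpa [hf₁.get aMk] using hmk
  · rw [← hL]
    exact nodup_predList ha hel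
  · rw [← hL]
    exact fun p hp => ((mem_predList ha).1 hp).1
  rintro t₂ M₂ ⟨ht₂, hmarked, htouched, htc, hf₂⟩
  have hlen : L.length ≤ n := by
    rw [← hL]
    exact length_predList_le ha hel
  refine (wp_splitTouched (n := n) (nb := nb) (L := L) (by omega) ?_ htouched (by omega)
    ?_).mono ?_
  · rwa [hf₂.get aBlk, hf₂.get aFst, hf₂.get aSz]
  · simpa [hf₂.get sNb, hf₁.get sNb] using hnb
  rintro t₃ M₃ ⟨ht₃, hS, hmk₃, hf₃⟩
  simp [hf₂.get aBlk, hf₁.get aBlk, hf₂.get aSz, hf₁.get aSz] at hS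
  simp [hf₃.get sC, hf₂.get sC, hf₁.get sC, hC]
  repeat refine ⟨by omega, ?_⟩
  rw [hL]
  exact ⟨by omega, hS, hmk₃, ((hf₁'.trans hf₂).trans hf₃).set⟩

/-- Refine the partition until all pairs of a block and a letter have been processed. -/
def refineLoop : Prog :=
  .loop (lt (var sC) (var sNb * eK)) refineStep

theorem input_tab {n k : ℕ} (A : PartialAutomaton (Fin n) (Fin k)) (p : Fin n) (a : Fin k) :
    input A aTab (p * k + a) = code (A.δ p a) := by
  simp [input, mul_add_lt_mul p.2 a.2, mul_add_div_of_lt p.val a.2,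
    mul_add_mod_self_of_lt p.val a.2]

theorem code_eq_succ_iff {n : ℕ} {x : Option (Fin n)} {s : ℕ} :
    code x = s + 1 ↔ ∃ u : Fin n, x = some u ∧ u.val = s := by
  cases x <;> simp [code]

theorem input_tab_le {n k : ℕ} (A : PartialAutomaton (Fin n) (Fin k)) (j : ℕ) :
    input A aTab j ≤ n := by
  have : ∀ x : Option (Fin n), code x ≤ n := by
    rintro (_ | u)
    · exact Nat.zero_le _
    · exact u.2
  simp only [input, one_ne_zero, if_false, if_true]
  split_ifs
  · exact this _
  · exact Nat.zero_le _

theorem wp_refineLoop {W n k : ℕ} (hW : 4 * (n * k + n + k + 1) < W)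
    (A : PartialAutomaton (Fin n) (Fin k)) {M : Memory} (hk : M 0 1 = k)
    (hch : ∀ x, Chain (M aNext) (M aHead x) (inEdges (input A aTab) k x (n * k)))
    (hpart : IsPartition n (M aEl) (M aPos) (M aBlk) (M aFst) (M aSz) 1)
    (hmk : ∀ b, M aMk b = 0) (hnb : M sNb 0 = 1) (hC : M sC 0 = 0) (hblk : ∀ p, M aBlk p = 0)
    (hsz : M aSz 0 = n) :
    WP W refineLoop M fun t M' => t ≤ 800 * (n * k) * (Nat.log 2 n + 1) + 10 ∧
      (∀ p q : Fin n, M' aBlk p = M' aBlk q ↔ A.insep.r p q) ∧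
      (∀ p < n, M' aBlk p < n) ∧
      Frame [aEl, aPos, aBlk, aFst, aSz, aMk, aList, aTch, sI, sX, sC, sNb, sCnt, sTc, sB, sJ, sEnd,
        sE, sP, sY, sQ, sM, sLen, sA] M M' := by
  have hpot := potential_init_le (input A aTab) (k := k) hblk hsz
  rw [refineLoop]
  -- A round takes at most `400` times as many steps as the potential decreases.
  refine wp_loop (fun t M' => t + 400 * potential (input A aTab) (M' aBlk) (M' aSz) n k (M' sC 0) ≤
      400 * potential (input A aTab) (M aBlk) (M aSz) n k 0 ∧
    IsPartition n (M' aEl) (M' aPos) (M' aBlk) (M' aFst) (M' aSz) (M' sNb 0) ∧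
    (∀ b, M' aMk b = 0) ∧ IsRefining A (M' aBlk) (M' sC 0) ∧ M' sC 0 ≤ n * k ∧
      Frame [aEl, aPos, aBlk, aFst, aSz, aMk, aList, aTch, sI, sX, sC, sNb, sCnt, sTc, sB, sJ, sEnd,
        sE, sP, sY, sQ, sM, sLen, sA] M M') (fun M' => n * k - M' sC 0) ?_ ?_ ?_ ?_
  · refine ⟨by simp [hC], by rwa [hnb], hmk, ⟨by simp [hblk], fun p q _ a => ?_⟩, by simp [hC],
      Frame.refl _ _⟩
    rw [hC]
    cases h1 : A.δ p a
    · cases h2 : A.δ q a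
      · simp
      · exact Or.inr (Or.inr ⟨_, rfl, Nat.zero_le _⟩)
    · exact Or.inr (Or.inl ⟨_, rfl, Nat.zero_le _⟩)
  · rintro t M' ⟨ht, hP, -, -, hc, hf⟩
    have h1 := hP.nb_le
    have h2 := Nat.mul_le_mul_right k h1
    simp [hf.get 0, hk]
    split_ifs <;> omega
  · rintro t M' ⟨ht, hP, hmk', hR, hc, hf⟩ h
    simp [hf.get 0, hk] at h
    have hk0 : 0 < k := Nat.pos_of_ne_zero (by rintro rfl; simp at h)
    have ha := Nat.mod_lt (M' sC 0) hk0
    have hb : M' sC 0 / k < M' sNb 0 := Nat.div_lt_of_lt_mul (by rwa [Nat.mul_comm])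
    have h2 := Nat.mul_le_mul_right k hP.nb_le
    refine (wp_refineStep (n := n) (k := k) (nb := M' sNb 0) (c := M' sC 0) hW
      (by rw [hf.get 0, hk]) (by rwa [hf.get aNext, hf.get aHead]) hP hmk' rfl rfl h).mono ?_
    rintro t' M'' ⟨L, hL, ht', hS, hmk'', hC', hf'⟩
    have hpot' := potential_step_le (input A aTab) hP hS h
    have hsz' := hP.sz_pos _ hb
    rw [← hL] at hpot'
    rw [hC']
    refine ⟨⟨?_, hS.part, hmk'', ?_, by omega, hf.trans hf'⟩, by omega⟩
    · simp
      omega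
    · refine hR.step hS hmk'' h ⟨_, ha⟩ rfl fun p => ?_
      rw [hL, mem_predList ha]
      have h3 := input_tab A p ⟨_, ha⟩
      simp only at h3
      rw [h3]
      simp only [code_eq_succ_iff]
      constructor
      · rintro ⟨-, j, hj, u, hu, huj⟩
        refine ⟨u, hu, ?_⟩
        rw [huj]
        exact (hP.seg _ hb _ (by omega) (by omega)).2
      · rintro ⟨u, hu, hub⟩
        have h4 := hP.mem u u.2
        rw [hub] at h4
        refine ⟨p.2, M' aPos u - M' aFst (M' sC 0 / k), by omega, u, hu, ?_⟩
        rw [Nat.add_sub_cancel' h4.1, hP.el_pos u u.2]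
  · rintro t M' ⟨ht, hP, hmk', hR, hc, hf⟩ h
    simp [hf.get 0, hk] at h
    refine ⟨?_, hR.blk_eq_iff hP.blk_lt h, fun p hp => ?_, hf⟩
    · simp
      have : 800 * (n * k) * (Nat.log 2 n + 1) = 400 * (2 * (n * k) * (Nat.log 2 n + 1)) := by ring
      omega
    · exact (hP.blk_lt p hp).trans_le hP.nb_le

end RAM

/-! ### Backward search and output -/

theorem Touched.length_le {mk tch : ℕ → ℕ} {nb tc : ℕ} (h : Touched mk tch nb 0 tc) :
    tc ≤ nb := by
  have := Finset.card_le_card_of_injOn (s := Finset.range tc) (t := Finset.range nb) tch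
    (fun j hj => by
      simp only [Finset.coe_range, Set.mem_Iio] at hj ⊢
      exact (h.lt j (Nat.zero_le _) hj).1)
    (fun j hj j' hj' hjj => by
      simp only [Finset.coe_range, Set.mem_Iio] at hj hj'
      exact h.inj j j' (Nat.zero_le _) hj (Nat.zero_le _) hj' hjj)
  simpa using this

namespace PartialAutomaton

/-- The choice of letters given by the array `lab`, which holds `0` for a block without a letter
and `a + 1` for a block with the letter `a`. -/
def labelRel {n k : ℕ} (blk lab : ℕ → ℕ) (p : Fin n) (a : Fin k) : Prop := lab (blk p) = a + 1

end PartialAutomaton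

open PartialAutomaton

/-- The state of the backward search from `r`. The array `queue` lists the states `p` with
`vis p ≠ 0`, which have been reached. The class of each reached state has a label, and the edges
given by the labels lead from each labelled class to the class of `r`. -/
structure IsSearch {n k : ℕ} (A : PartialAutomaton (Fin n) (Fin k)) (blk vis queue lab : ℕ → ℕ)
    (qn : ℕ) (r : Fin n) : Prop where
  touched : Touched vis queue n 0 qn
  vis_le : ∀ p, vis p ≤ 1
  lab_le : ∀ b, lab b ≤ k + 1
  vis_root : vis r ≠ 0
  lab_ne_zero : ∀ p : Fin n, vis p ≠ 0 → lab (blk p) ≠ 0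
  reach : ∀ p : Fin n, lab (blk p) ≠ 0 → Relation.ReflTransGen
    (fun c d => ∃ a, (c, d, a) ∈ A.labelEdges (labelRel blk lab) r) (A.cls p) (A.cls r)

section
variable {n k : ℕ} {A : PartialAutomaton (Fin n) (Fin k)} {blk vis queue lab : ℕ → ℕ}
  {qn : ℕ} {r : Fin n}

theorem IsSearch.visit (h : IsSearch A blk vis queue lab qn r)
    (hblk : ∀ p q : Fin n, blk p = blk q ↔ A.insep.r p q) {p s : Fin n} {a : Fin k}
    (hp : vis p = 0) (hs : vis s ≠ 0) (hps : A.δ p a = some s) :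
    IsSearch A blk (Function.update vis p 1) (Function.update queue qn p)
      (if lab (blk p) = 0 then Function.update lab (blk p) (a + 1) else lab) (qn + 1) r where
  touched := h.touched.push (Nat.zero_le _) p.2 hp one_ne_zero
  vis_le q := by
    have := h.vis_le q
    rw [Function.update_apply]
    split_ifs <;> omega
  lab_le b := by
    have hb := h.lab_le b
    have := a.2
    split_ifs
    · rw [Function.update_apply]
      split_ifs <;> omega
    · exact hb
  vis_root := by
    have := h.vis_root
    rw [Function.update_apply]
    split_ifs <;> omega
  lab_ne_zero q hq := by
    have hlab := h.lab_ne_zero q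
    rw [Function.update_apply] at hq
    by_cases h1 : blk q = blk p
    · rw [h1]
      split_ifs with h2
      · simp
      · exact h2
    · rw [if_neg (by rintro h2; exact h1 (by rw [h2]))] at hq
      split_ifs with h2
      · rw [Function.update_of_ne h1]
        exact hlab hq
      · exact hlab hq
  reach q hq := by
    by_cases h1 : lab (blk p) = 0
    · rw [if_pos h1] at hq ⊢
      have hmono := A.labelEdges_mono (r := r) (L := labelRel blk lab)
        (L' := labelRel blk (Function.update lab (blk p) (a + 1))) (fun q b _ hb => by
          unfold labelRel at hb ⊢
          rw [Function.update_of_ne, hb]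
          intro h2
          rw [h2] at hb
          omega)
      have hold : ∀ q : Fin n, lab (blk q) ≠ 0 → Relation.ReflTransGen (fun c d => ∃ b, (c, d, b) ∈
          A.labelEdges (labelRel blk (Function.update lab (blk p) (a + 1))) r)
          (A.cls q) (A.cls r) :=
        fun q hq => Relation.ReflTransGen.mono (fun _ _ ⟨b, hb⟩ => ⟨b, hmono hb⟩) _ _ (h.reach q hq)
      by_cases h2 : blk q = blk p
      · have h3 : A.cls q = A.cls p := Quotient.sound ((hblk q p).1 h2)
        rw [h3]
        refine .head ⟨a, p, s, rfl, rfl, ?_, ?_, hps⟩ (hold s (h.lab_ne_zero s hs))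
        · intro h4
          exact h.lab_ne_zero r h.vis_root (by rw [← (hblk p r).2 h4, h1])
        · simp [labelRel]
      · rw [Function.update_of_ne h2] at hq
        exact hold q hq
    · rw [if_neg h1] at hq ⊢
      exact h.reach q hq

/-- If the set of reached states is closed under predecessors, then the labels give a collecting
tree. -/
theorem IsSearch.exists_collectingTree (h : IsSearch A blk vis queue lab qn r)
    (hblk : ∀ p q : Fin n, blk p = blk q ↔ A.insep.r p q) (hA : A.StronglyConnected)
    (hclosed : ∀ p s a, A.δ p a = some s → vis s ≠ 0 → vis p ≠ 0) :
    ∃ T : A.CollectingTree, T.root = A.cls r ∧ T.edges = A.labelEdges (labelRel blk lab) r := by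
  have hvis : ∀ w p, A.run p w = some r → vis p ≠ 0 := by
    intro w
    induction w with
    | nil =>
      intro p hp
      simp only [run, Option.some.injEq] at hp
      rw [hp]
      exact h.vis_root
    | cons a w ih =>
      intro p hp
      simp only [run, Option.bind_eq_some_iff] at hp
      obtain ⟨s, hs, hp⟩ := hp
      exact hclosed p s a hs (ih s hp)
  refine A.exists_collectingTree (fun p q a hpq hp => ?_) (fun p a b ha hb => ?_) fun p => ?_
  · rw [labelRel, ← (hblk p q).2 hpq]
    exact hp
  · unfold labelRel at ha hb
    exact Fin.ext (by omega)
  · obtain ⟨w, hw⟩ := hA p r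
    exact h.reach p (h.lab_ne_zero p (hvis w p hw))

end

namespace RAM
open RAM.Expr

/-- Process the states `p` with a transition to the state `queue[sC / k]` under the letter
`sC % k`. -/
def searchChain : Prog :=
  .loop (var sE)
    (.write sP 0 ((var sE - 1) / eK) ;;
     .cond (.read aVis (var sP)) .skip
       (.write aVis (var sP) 1 ;;
        .write aQueue (var sQn) (var sP) ;;
        .write sQn 0 (var sQn + 1) ;;
        .cond (.read aLab (.read aBlk (var sP))) .skip
          (.write aLab (.read aBlk (var sP)) (var sC % eK + 1))) ;;
     .write sE 0 (.read aNext (var sE - 1)))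

theorem wp_searchChain {W n k : ℕ} (hW : 4 * (n * k + n + k + 1) < W)
    {A : PartialAutomaton (Fin n) (Fin k)} {M : Memory} {l : List ℕ} {r s : Fin n} {a : Fin k}
    (hk : M 0 1 = k) (hch : Chain (M aNext) (M sE 0) l)
    (hl : ∀ j ∈ l, j < n * k ∧ ∃ p : Fin n, p.val = j / k ∧ A.δ p a = some s)
    (hC : M sC 0 % k = a) (hCn : M sC 0 < n * k)
    (hblk : ∀ p q : Fin n, M aBlk p = M aBlk q ↔ A.insep.r p q) (hblkn : ∀ p < n, M aBlk p < n)
    (hsearch : IsSearch A (M aBlk) (M aVis) (M aQueue) (M aLab) (M sQn 0) r)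
    (hs : M aVis s ≠ 0) :
    WP W searchChain M fun t M' => t ≤ 60 * l.length + 3 ∧
      IsSearch A (M aBlk) (M' aVis) (M' aQueue) (M' aLab) (M' sQn 0) r ∧
      (∀ j ∈ l, M' aVis (j / k) ≠ 0) ∧ (∀ p, M aVis p ≠ 0 → M' aVis p ≠ 0) ∧
      M sQn 0 ≤ M' sQn 0 ∧ (∀ i < M sQn 0, M' aQueue i = M aQueue i) ∧
      Frame [aVis, aQueue, aLab, sE, sP, sQn] M M' := by
  rw [searchChain]
  refine wp_loop_count l.length (fun i t M' => t ≤ 60 * i ∧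
      Chain (M aNext) (M' sE 0) (l.drop i) ∧
      IsSearch A (M aBlk) (M' aVis) (M' aQueue) (M' aLab) (M' sQn 0) r ∧
      (∀ j ∈ l.take i, M' aVis (j / k) ≠ 0) ∧ (∀ p, M aVis p ≠ 0 → M' aVis p ≠ 0) ∧
      M sQn 0 ≤ M' sQn 0 ∧ (∀ i < M sQn 0, M' aQueue i = M aQueue i) ∧
      Frame [aVis, aQueue, aLab, sE, sP, sQn] M M') ?_ ?_ ?_ ?_ ?_
  · exact ⟨le_rfl, by simpa using hch, hsearch, by simp, fun _ h => h, le_rfl, fun _ _ => rfl,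
      Frame.refl _ _⟩
  · rintro i t M' hi ⟨ht, hch', -⟩
    have := hch'.le fun j hj => (hl j (List.mem_of_mem_drop hj)).1
    simp
    omega
  · rintro i t M' hi ⟨ht, hch', -⟩
    simp only [eval_read, eval_zero]
    obtain rfl | hi := hi.eq_or_lt
    · simpa [Chain] using hch'
    · rw [List.drop_eq_getElem_cons hi] at hch'
      simp [hch'.1, hi]
  · rintro i t M' hi ⟨ht, hch', hS, hdone, hmono, hqn, hqueue, hf⟩
    rw [List.drop_eq_getElem_cons hi] at hch'
    obtain ⟨h1, p, hp, hps⟩ := hl l[i] (List.getElem_mem hi)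
    have h2 := hch'.2.le fun j hj => (hl j (List.mem_of_mem_drop hj)).1
    have h3 := hch'.1
    have hqn' := hS.touched.length_le
    have hvp := hS.vis_le p
    have hlp := hS.lab_le (M aBlk p)
    have hbp := hblkn p p.2
    have hpn := p.2
    have han := a.2
    have hdone' : ∀ vis' : ℕ → ℕ, (∀ q, M' aVis q ≠ 0 → vis' q ≠ 0) → vis' p ≠ 0 →
        ∀ j ∈ l.take (i + 1), vis' (j / k) ≠ 0 := by
      intro vis' h4 h5 j hj
      rw [List.take_add_one, List.getElem?_eq_getElem hi, List.mem_append] at hj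
      rcases hj with hj | hj
      · exact h4 _ (hdone j hj)
      · simp only [Option.toList_some, List.mem_singleton] at hj
        rwa [hj, ← hp]
    by_cases hv : M' aVis p = 0
    · have hvisit := hS.visit hblk hv (hmono s hs) hps
      have hvis' : ∀ q, M' aVis q ≠ 0 → Function.update (M' aVis) p 1 q ≠ 0 := by
        intro q hq
        rw [Function.update_apply]
        split_ifs <;> omega
      have hdone'' := hdone' _ hvis' (by simp)
      have hqueue' : ∀ i < M sQn 0, Function.update (M' aQueue) (M' sQn 0) p i = M aQueue i := by
        intro i hi
        rw [Function.update_of_ne (by omega), hqueue i hi]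
      by_cases hlab : M' aLab (M aBlk p) = 0
      · rw [if_pos hlab] at hvisit
        simp only [wp_seq, wp_write, wp_cond, wp_skip]
        simp [hf.get 0, hf.get aNext, hf.get aBlk, hf.get sC, hk, h3, ← hp, hv, hlab, hC]
        repeat refine ⟨by omega, ?_⟩
        exact ⟨hch'.2, hvisit, hdone'', fun q hq => hvis' q (hmono q hq), by omega, hqueue',
          hf.set.set.set.set.set.set⟩
      · rw [if_neg hlab] at hvisit
        simp only [wp_seq, wp_write, wp_cond, wp_skip]
        simp [hf.get 0, hf.get aNext, hf.get aBlk, hk, h3, ← hp, hv, hlab]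
        repeat refine ⟨by omega, ?_⟩
        exact ⟨hch'.2, hvisit, hdone'', fun q hq => hvis' q (hmono q hq), by omega, hqueue',
          hf.set.set.set.set.set⟩
    · simp only [wp_seq, wp_write, wp_cond, wp_skip]
      simp [hf.get 0, hf.get aNext, hk, h3, ← hp, hv]
      repeat refine ⟨by omega, ?_⟩
      exact ⟨hch'.2, hS, hdone' _ (fun _ h => h) hv, hmono, hqn, hqueue, hf.set.set⟩
  · rintro t M' ⟨ht, -, hS, hdone, hmono, hqn, hqueue, hf⟩
    rw [List.take_length] at hdone
    exact ⟨by simp; omega, hS, hdone, hmono, hqn, hqueue, hf⟩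

/-- Backward search from the state `0`. On the first visit to a class other than that of the state
`0`, the letter of the transition used becomes the label of the class. -/
def searchLoop : Prog :=
  .write aVis 0 1 ;;
  .write aQueue 0 0 ;;
  .write aLab (.read aBlk 0) 1 ;;
  .write sQn 0 1 ;;
  .write sC 0 0 ;;
  .loop (lt (var sC) (var sQn * eK))
    (.write sE 0 (.read aHead (.read aQueue (var sC / eK) * eK + var sC % eK)) ;;
     searchChain ;;
     .write sC 0 (var sC + 1))

/-- The pairs of a state in the queue and a letter are distinct, so that any sum over these pairs
is at most the sum over all pairs. -/
theorem sum_queue_le {vis queue : ℕ → ℕ} {n k qn c : ℕ} (h : Touched vis queue n 0 qn)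
    (hc : c ≤ qn * k) (g : ℕ → ℕ) :
    ∑ j ∈ Finset.range c, g (queue (j / k) * k + j % k) ≤ ∑ x ∈ Finset.range (n * k), g x := by
  obtain rfl | hk := k.eq_zero_or_pos
  · obtain rfl : c = 0 := by simpa using hc
    simp
  have hdiv : ∀ j < c, j / k < qn := fun j hj =>
    Nat.div_lt_of_lt_mul (by rw [Nat.mul_comm]; omega)
  rw [← Finset.sum_image (f := g) (g := fun j => queue (j / k) * k + j % k)]
  · refine Finset.sum_le_sum_of_subset fun x hx => ?_
    obtain ⟨j, hj, rfl⟩ := Finset.mem_image.1 hx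
    rw [Finset.mem_range] at hj ⊢
    exact mul_add_lt_mul (h.lt _ (Nat.zero_le _) (hdiv j hj)).1 (Nat.mod_lt _ hk)
  · intro i hi j hj hij
    simp only [Finset.coe_range, Set.mem_Iio] at hi hj
    obtain ⟨h1, h2⟩ := mul_add_inj (Nat.mod_lt _ hk) (Nat.mod_lt _ hk) hij
    have h3 := h.inj _ _ (Nat.zero_le _) (hdiv i hi) (Nat.zero_le _) (hdiv j hj) h1
    rw [← Nat.div_add_mod' i k, ← Nat.div_add_mod' j k, h2, h3]

theorem wp_searchLoop {W n k : ℕ} (hW : 4 * (n * k + n + k + 1) < W) (hn0 : 0 < n)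
    {A : PartialAutomaton (Fin n) (Fin k)} {M : Memory} (hk : M 0 1 = k)
    (hch : ∀ x, Chain (M aNext) (M aHead x) (inEdges (input A aTab) k x (n * k)))
    (hblk : ∀ p q : Fin n, M aBlk p = M aBlk q ↔ A.insep.r p q) (hblkn : ∀ p < n, M aBlk p < n)
    (hvis : ∀ p, M aVis p = 0) (hlab : ∀ b, M aLab b = 0) (hA : A.StronglyConnected) :
    WP W searchLoop M fun t M' => t ≤ 160 * (n * k) + 50 ∧
      (∃ T : A.CollectingTree, T.root = A.cls ⟨0, hn0⟩ ∧
        T.edges = A.labelEdges (labelRel (M aBlk) (M' aLab)) ⟨0, hn0⟩) ∧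
      (∀ b, M' aLab b ≤ k + 1) ∧
      Frame [aVis, aQueue, aLab, sE, sP, sQn, sC] M M' := by
  have hb0 := hblkn 0 hn0
  rw [searchLoop]
  simp only [wp_seq, wp_write]
  simp
  repeat refine ⟨by omega, ?_⟩
  -- The time is bounded by a sum over the pairs processed so far, that is, over the pairs of the state
  -- `queue[j / k]` and the letter `j % k`, which are distinct.
  refine wp_loop (fun t M' => t ≤ ∑ j ∈ Finset.range (M' sC 0),
      (60 * (inEdges (input A aTab) k (M' aQueue (j / k) * k + j % k) (n * k)).length + 50) ∧
    M' sC 0 ≤ M' sQn 0 * k ∧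
    IsSearch A (M aBlk) (M' aVis) (M' aQueue) (M' aLab) (M' sQn 0) ⟨0, hn0⟩ ∧
    (∀ i < M' sQn 0, ∀ a : Fin k, i * k + a < M' sC 0 → ∀ p s : Fin n, A.δ p a = some s →
      M' aQueue i = s → M' aVis p ≠ 0) ∧
    Frame [aVis, aQueue, aLab, sE, sP, sQn, sC] M M') (fun M' => n * k - M' sC 0) ?_ ?_ ?_ ?_
  · refine ⟨by simp, by simp, ?_, by simp, (Frame.refl _ _).set.set.set.set.set⟩
    refine ⟨?_, ?_, ?_, ?_, ?_, ?_⟩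
    · simp
      refine ⟨fun j _ h => ?_, fun j j' _ h _ h' _ => by omega, fun b hb => ?_⟩
      · obtain rfl : j = 0 := by omega
        simpa using hn0
      · refine ⟨0, le_rfl, one_pos, ?_⟩
        by_contra h
        rw [Function.update_of_ne (fun h' => h (by simp [h'])), hvis] at hb
        exact hb rfl
    · intro p
      simp [Function.update_apply, hvis]
      split_ifs <;> omega
    · intro b
      simp [Function.update_apply, hlab]
      split_ifs <;> omega
    · simp
    · intro p hp
      simp [Function.update_apply, hvis] at hp
      simp [hp]
    · intro p hp
      have : M aBlk p = M aBlk 0 := by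
        by_contra h
        simp [h, hlab] at hp
      have h2 : A.cls p = A.cls ⟨0, hn0⟩ := Quotient.sound ((hblk p ⟨0, hn0⟩).1 this)
      rw [h2]
  · rintro t M' ⟨ht, hc, hS, -, hf⟩
    have hqn := hS.touched.length_le
    have h2 := Nat.mul_le_mul_right k hqn
    simp [hf.get 0, hk]
    split_ifs <;> omega
  · rintro t M' ⟨ht, hc, hS, hclosed, hf⟩ h
    simp [hf.get 0, hk] at h
    have hk0 : 0 < k := Nat.pos_of_ne_zero (by rintro rfl; simp at h)
    have hmod := Nat.mod_lt (M' sC 0) hk0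
    have hdiv : M' sC 0 / k < M' sQn 0 := Nat.div_lt_of_lt_mul (by rwa [Nat.mul_comm])
    have hqn := hS.touched.length_le
    have h2 := Nat.mul_le_mul_right k hqn
    obtain ⟨hq1, hq2⟩ := hS.touched.lt _ (Nat.zero_le _) hdiv
    have hx := mul_add_lt_mul hq1 hmod
    have hd := Nat.div_add_mod' (M' sC 0) k
    have hhead := (hch (M' aQueue (M' sC 0 / k) * k + M' sC 0 % k)).le
      fun j hj => (mem_inEdges.1 hj).1
    simp only [wp_seq, wp_write]
    simp [hf.get 0, hf.get aHead, hk]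
    repeat refine ⟨by omega, ?_⟩
    refine (wp_searchChain (n := n) (k := k) (A := A) (r := ⟨0, hn0⟩)
      (s := ⟨M' aQueue (M' sC 0 / k), hq1⟩) (a := ⟨M' sC 0 % k, hmod⟩)
      (l := inEdges (input A aTab) k (M' aQueue (M' sC 0 / k) * k + M' sC 0 % k) (n * k)) hW
      (by simp [hf.get 0, hk]) (by simpa [hf.get aNext] using hch _) ?_ (by simp)
      (by simp; omega) (by simpa [hf.get aBlk] using hblk) (by simpa [hf.get aBlk] using hblkn)
      (by simpa [hf.get aBlk] using hS) (by simpa using hq2)).mono ?_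
    · intro j hj
      have h3 := List.mem_map_of_mem (f := (· / k)) hj
      rw [mem_inEdges_map hmod] at h3
      refine ⟨(mem_inEdges.1 hj).1, ⟨j / k, h3.1⟩, rfl, ?_⟩
      have h4 := input_tab A ⟨j / k, h3.1⟩ ⟨_, hmod⟩
      simp only at h3 h4
      rw [h4, code_eq_succ_iff] at h3
      obtain ⟨-, u, hu, hu'⟩ := h3
      rw [hu]
      exact congrArg some (Fin.ext hu')
    · rintro t' M'' ⟨ht', hS', hdone, hmono, hqn', hqueue, hf'⟩
      simp [hf.get aBlk] at hS' hmono hqn' hqueue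
      simp [hf'.get sC]
      repeat refine ⟨by omega, ?_⟩
      refine ⟨⟨?_, by have := Nat.mul_le_mul_right k hqn'; omega, hS', ?_,
        (hf.set.trans hf').set⟩, by omega⟩
      · rw [Finset.sum_range_succ, hqueue _ hdiv]
        have : ∀ j ∈ Finset.range (M' sC 0), M'' aQueue (j / k) = M' aQueue (j / k) := by
          intro j hj
          rw [Finset.mem_range] at hj
          exact hqueue _ ((Nat.div_le_div_right hj.le).trans_lt hdiv)
        rw [Finset.sum_congr rfl fun j hj => by rw [this j hj]]
        omega
      · intro i hi a hia p s hps his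
        by_cases h3 : i * k + a = M' sC 0
        · obtain ⟨h4, h5⟩ := mul_add_inj a.2 hmod (h3.trans hd.symm)
          rw [h4, hqueue _ hdiv] at his
          have h6 : p.val ∈ (inEdges (input A aTab) k (M' aQueue (M' sC 0 / k) * k +
              M' sC 0 % k) (n * k)).map (· / k) := by
            rw [mem_inEdges_map hmod, ← h5, input_tab A p a, hps, his]
            exact ⟨p.2, rfl⟩
          obtain ⟨j, hj, hjp⟩ := List.mem_map.1 h6
          rw [← hjp]
          exact hdone j hj
        · have h4 : i < M' sQn 0 := by
            by_contra h4
            have := Nat.mul_le_mul_right k (not_lt.1 h4)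
            omega
          rw [hqueue i h4] at his
          exact hmono _ (hclosed i h4 a (by omega) p s hps his)
  · rintro t M' ⟨ht, hc, hS, hclosed, hf⟩ h
    simp [hf.get 0, hk] at h
    refine ⟨?_, hS.exists_collectingTree hblk hA fun p s a hps hs => ?_, hS.lab_le, hf⟩
    · have h3 := ht.trans (sum_queue_le hS.touched hc
        fun x => 60 * (inEdges (input A aTab) k x (n * k)).length + 50)
      rw [Finset.sum_add_distrib, ← Finset.mul_sum] at h3
      have := sum_length_inEdges_le (input A aTab) k (n * k) (n * k)
      simp at h3 ⊢
      omega
    · obtain ⟨i, -, hi, his⟩ := hS.touched.surj s hs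
      exact hclosed i hi a ((mul_add_lt_mul hi a.2).trans_le h) p s hps his

/-- Write the collecting automaton. -/
def writeOutput : Prog :=
  .write 2 0 eN ;;
  .write 2 1 (eK + 1) ;;
  .write sI 0 0 ;;
  .loop (lt (var sI) (eN * eK))
    (.cond (.read aTab (var sI))
       (.write aOut (var sI + var sI / eK) (.read aTab (var sI)))
       (.write aOut (var sI + var sI / eK) (var sI / eK + 1)) ;;
     .write sI 0 (var sI + 1)) ;;
  .write sI 0 0 ;;
  .loop (lt (var sI) eN)
    (.cond (eq (.read aBlk (var sI)) (.read aBlk 0))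
       (.write aOut (var sI * (eK + 1) + eK) (var sI + 1))
       (.write aOut (var sI * (eK + 1) + eK)
         (.read aTab (var sI * eK + (.read aLab (.read aBlk (var sI)) - 1)))) ;;
     .write sI 0 (var sI + 1))

theorem wp_writeOutput {W n k : ℕ} (hW : 4 * (n * k + n + k + 1) < W) (hn0 : 0 < n) {M : Memory}
    (hn : M 0 0 = n) (hk : M 0 1 = k) (htab : ∀ j, M aTab j ≤ n) (hblkn : ∀ p < n, M aBlk p < n)
    (hlab : ∀ b, M aLab b ≤ k + 1) :
    WP W writeOutput M fun t M' => t ≤ 60 * (n * k) + 60 * n + 60 ∧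
      M' 2 0 = n ∧ M' 2 1 = k + 1 ∧
      (∀ q < n, ∀ a < k, M' aOut (q * (k + 1) + a) =
        if M aTab (q * k + a) = 0 then q + 1 else M aTab (q * k + a)) ∧
      (∀ q < n, M' aOut (q * (k + 1) + k) = if M aBlk q = M aBlk 0 then q + 1 else
        M aTab (q * k + (M aLab (M aBlk q) - 1))) := by
  have hb0 := hblkn 0 hn0
  rw [writeOutput]
  simp only [wp_seq, wp_write]
  simp [hn, hk]
  repeat refine ⟨by omega, ?_⟩
  refine wp_loop_count (n * k) (fun i t M' => t ≤ 60 * i ∧ M' sI 0 = i ∧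
    M' 2 0 = n ∧ M' 2 1 = k + 1 ∧ (∀ j < i, M' aOut (j + j / k) =
      if M aTab j = 0 then j / k + 1 else M aTab j) ∧ Frame [2, aOut, sI] M M') ?_ ?_ ?_ ?_ ?_
  · exact ⟨by simp, by simp, by simp, by simp, by simp, (Frame.refl _ _).set.set.set⟩
  · rintro i t M' hi ⟨ht, hi', -, -, -, hf⟩
    simp [hi', hf.get 0, hn, hk]
    split_ifs <;> omega
  · rintro i t M' hi ⟨ht, hi', -, -, -, hf⟩
    simp [hi', hf.get 0, hn, hk]
  · rintro i t M' hi ⟨ht, hi', h20, h21, hout, hf⟩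
    have htab' := htab i
    have hdiv := Nat.div_le_self i k
    have hne : ∀ j < i, j + j / k ≠ i + i / k := fun j hj => by
      have := Nat.div_le_div_right (c := k) hj.le
      omega
    simp only [wp_seq, wp_write, wp_cond]
    by_cases h : M aTab i = 0
    · simp [hi', hf.get aTab, hf.get 0, hk, h]
      repeat refine ⟨by omega, ?_⟩
      refine ⟨fun j hj => ?_, hf.set.set⟩
      by_cases hji : j = i
      · simp [hji, h]
      · rw [Function.update_of_ne (hne j (by omega))]
        exact hout j (by omega)
    · simp [hi', hf.get aTab, hf.get 0, hk, h]
      repeat refine ⟨by omega, ?_⟩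
      refine ⟨fun j hj => ?_, hf.set.set⟩
      by_cases hji : j = i
      · simp [hji, h]
      · rw [Function.update_of_ne (hne j (by omega))]
        exact hout j (by omega)
  · rintro t M₁ ⟨ht, hi', h20, h21, hout, hf⟩
    have hout' : ∀ q < n, ∀ a < k, M₁ aOut (q * (k + 1) + a) =
        if M aTab (q * k + a) = 0 then q + 1 else M aTab (q * k + a) := by
      intro q hq a ha
      have h1 := hout _ (mul_add_lt_mul hq ha)
      rw [mul_add_div_of_lt _ ha] at h1
      rw [← h1]
      congr 1
      ring
    simp
    repeat refine ⟨by omega, ?_⟩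
    refine wp_loop_count n (fun i t M' => t ≤ 60 * i ∧ M' sI 0 = i ∧
      M' 2 0 = n ∧ M' 2 1 = k + 1 ∧ (∀ q < n, ∀ a < k, M' aOut (q * (k + 1) + a) =
        if M aTab (q * k + a) = 0 then q + 1 else M aTab (q * k + a)) ∧
      (∀ q < i, M' aOut (q * (k + 1) + k) = if M aBlk q = M aBlk 0 then q + 1 else
        M aTab (q * k + (M aLab (M aBlk q) - 1))) ∧
      Frame [2, aOut, sI] M M') ?_ ?_ ?_ ?_ ?_
    · exact ⟨by simp, by simp, by simpa using h20, by simpa using h21, by simpa using hout',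
        by simp, hf.set⟩
    · rintro i t M' hi ⟨ht, hi', -, -, -, -, hf⟩
      simp [hi', hf.get 0, hn]
      split_ifs <;> omega
    · rintro i t M' hi ⟨ht, hi', -, -, -, -, hf⟩
      simp [hi', hf.get 0, hn]
    · rintro i t M' hi ⟨ht, hi', h20, h21, hout₁, hout₂, hf⟩
      have hlab' := hlab (M aBlk i)
      have hbi := hblkn i hi
      have hik := Nat.mul_le_mul_right k hi.le
      have hik' : i * (k + 1) = i * k + i := by ring
      have htab' := htab (i * k + (M aLab (M aBlk i) - 1))
      have hnew : ∀ v q, q < n → ∀ a < k,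
          Function.update (M' aOut) (i * (k + 1) + k) v (q * (k + 1) + a) =
            M' aOut (q * (k + 1) + a) := by
        intro v q hq a ha
        refine Function.update_of_ne (fun h => ?_) _ _
        have := (mul_add_inj (by omega) (by omega) h).2
        omega
      have hold : ∀ v q, q < i → Function.update (M' aOut) (i * (k + 1) + k) v (q * (k + 1) + k) =
          M' aOut (q * (k + 1) + k) := by
        intro v q hq
        refine Function.update_of_ne (fun h => ?_) _ _
        have := (mul_add_inj (by omega) (by omega) h).1
        omega
      simp only [wp_seq, wp_write, wp_cond]
      by_cases h : M aBlk i = M aBlk 0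
      · simp [hi', hf.get aBlk, hf.get 0, hk, h]
        repeat refine ⟨by omega, ?_⟩
        refine ⟨fun q hq a ha => ?_, fun q hq => ?_, hf.set.set⟩
        · rw [hnew _ q hq a ha, hout₁ q hq a ha]
        · by_cases hqi : q = i
          · simp [hqi, h]
          · rw [hold _ q (by omega), hout₂ q (by omega)]
      · simp [hi', hf.get aBlk, hf.get 0, hf.get aTab, hf.get aLab, hk, h]
        repeat refine ⟨by omega, ?_⟩
        refine ⟨fun q hq a ha => ?_, fun q hq => ?_, hf.set.set⟩
        · rw [hnew _ q hq a ha, hout₁ q hq a ha]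
        · by_cases hqi : q = i
          · simp [hqi, h]
          · rw [hold _ q (by omega), hout₂ q (by omega)]
    · rintro t M' ⟨ht, hi', h20, h21, hout₁, hout₂, -⟩
      refine ⟨?_, h20, h21, hout₁, hout₂⟩
      simp
      omega

end RAM

/-! ### The algorithm -/

namespace RAM

/-- The algorithm that constructs a collecting automaton. -/
def collectingProg : Prog :=
  linkEdges ;; initPartition ;; refineLoop ;; searchLoop ;; writeOutput

theorem wp_collectingProg {W n k : ℕ} (hW : 4 * (n * k + n + k + 1) < W) (hn0 : 0 < n)
    (A : PartialAutomaton (Fin n) (Fin k)) (hA : A.StronglyConnected) :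
    WP W collectingProg (input A) fun t M =>
      t ≤ 800 * (n * k) * (Nat.log 2 n + 1) + 280 * (n * k) + 90 * n + 182 ∧
      ∃ T : A.CollectingTree, IsOutput M ((A.collecting T).relabel finSuccEquivLast) := by
  have hzero : ∀ r, 2 ≤ r → ∀ i, input A r i = 0 := fun r hr i => by
    simp [input, show r ≠ 0 by omega, show r ≠ 1 by omega]
  have hN : input A 0 0 = n := by simp [input]
  have hK : input A 0 1 = k := by simp [input]
  rw [collectingProg, wp_seq]
  refine (wp_linkEdges hW hN hK (fun j _ => input_tab_le A j) (hzero _ (by norm_num))).mono ?_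
  rintro t₁ M₁ ⟨ht₁, hch, hf₁⟩
  rw [wp_seq]
  refine (wp_initPartition (W := W) (n := n) (by omega) hn0 (by rw [hf₁.get 0, hN])
    (fun p => by rw [hf₁.get aBlk, hzero _ (by norm_num)])
    (by rw [hf₁.get aFst, hzero _ (by norm_num)])).mono ?_
  rintro t₂ M₂ ⟨ht₂, hpart, hnb, hC, hf₂⟩
  have hblk₂ : ∀ p, M₂ aBlk p = 0 := fun p => by
    rw [hf₂.get aBlk, hf₁.get aBlk, hzero _ (by norm_num)]
  have hsz₂ : M₂ aSz 0 = n := by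
    have h1 := hpart.seg_le one_pos
    have h2 := hpart.mem (M₂ aEl (n - 1)) (hpart.el_lt _ (by omega))
    rw [hblk₂, hpart.pos_el _ (by omega)] at h2
    rw [hf₂.get aFst, hf₁.get aFst, hzero _ (by norm_num)] at h1 h2
    omega
  rw [wp_seq]
  refine (wp_refineLoop hW A (by rw [hf₂.get 0, hf₁.get 0, hK])
    (by rwa [hf₂.get aNext, hf₂.get aHead]) hpart
    (fun b => by rw [hf₂.get aMk, hf₁.get aMk, hzero _ (by norm_num)]) hnb hC hblk₂ hsz₂).mono ?_
  rintro t₃ M₃ ⟨ht₃, hblk, hblkn, hf₃⟩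
  rw [wp_seq]
  refine (wp_searchLoop hW hn0 (by rw [hf₃.get 0, hf₂.get 0, hf₁.get 0, hK])
    (by rwa [hf₃.get aNext, hf₃.get aHead, hf₂.get aNext, hf₂.get aHead]) hblk hblkn
    (fun p => by rw [hf₃.get aVis, hf₂.get aVis, hf₁.get aVis, hzero _ (by norm_num)])
    (fun b => by rw [hf₃.get aLab, hf₂.get aLab, hf₁.get aLab, hzero _ (by norm_num)]) hA).mono ?_
  rintro t₄ M₄ ⟨ht₄, ⟨T, hroot, hedges⟩, hlab, hf₄⟩
  have htab : M₄ aTab = input A aTab := by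
    rw [hf₄.get aTab, hf₃.get aTab, hf₂.get aTab, hf₁.get aTab]
  refine (wp_writeOutput hW hn0 (by rw [hf₄.get 0, hf₃.get 0, hf₂.get 0, hf₁.get 0, hN])
    (by rw [hf₄.get 0, hf₃.get 0, hf₂.get 0, hf₁.get 0, hK])
    (fun j => by rw [htab]; exact input_tab_le A j) (by rwa [hf₄.get aBlk]) hlab).mono ?_
  rintro t₅ M₅ ⟨ht₅, h20, h21, hold, hnew⟩
  refine ⟨by omega, T, h20, h21, fun q a => ?_⟩
  rw [htab] at hold hnew
  rw [hf₄.get aBlk] at hnew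
  induction a using Fin.lastCases with
  | last =>
    rw [Fin.val_last, hnew q q.2]
    simp only [PartialAutomaton.relabel, finSuccEquivLast_last]
    have hq := hblk q ⟨0, hn0⟩
    by_cases h : M₃ aBlk q = M₃ aBlk 0
    · rw [if_pos h, A.collecting_none_root T (by rw [hroot]; exact Quotient.sound (hq.1 h))]
      rfl
    · have hne : A.cls q ≠ T.root := by
        rw [hroot]
        exact fun h' => h (hq.2 (Quotient.exact h'))
      obtain ⟨⟨d, a⟩, he, -⟩ := T.existsUnique_edge _ hne
      rw [if_neg h, A.collecting_none T he, ← input_tab A q a]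
      rw [hedges] at he
      obtain ⟨p, -, hp, -, -, hpa, -⟩ := he
      simp only [PartialAutomaton.labelRel] at hp hpa
      rw [(hblk q p).2 (Quotient.exact hp), hpa, Nat.add_sub_cancel]
  | cast a =>
    rw [Fin.val_castSucc, hold q q.2 a a.2, input_tab]
    simp only [PartialAutomaton.relabel, finSuccEquivLast_castSucc, PartialAutomaton.collecting,
      PartialAutomaton.fixing]
    cases A.δ q a <;> simp [code]

end RAM

/-- There is only one state if there are no letters. -/
theorem PartialAutomaton.StronglyConnected.card_le {n k : ℕ}
    {A : PartialAutomaton (Fin n) (Fin k)} (hA : A.StronglyConnected) : n ≤ n * k + 1 := by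
  obtain rfl | hk := k.eq_zero_or_pos
  · by_contra h
    obtain ⟨w, hw⟩ := hA ⟨0, by omega⟩ ⟨1, by omega⟩
    cases w with
    | nil => simp [run] at hw
    | cons a _ => exact a.elim0
  · exact (Nat.le_mul_of_pos_right n hk).trans (Nat.le_succ _)

theorem theorem3p10 :
    ∃ (P : RAM.Prog) (C c : ℕ), ∀ (n k : ℕ) (A : PartialAutomaton (Fin n) (Fin k)),
      0 < n → A.StronglyConnected →
      ∃ (B : PartialAutomaton (Fin n) (Fin (k + 1))) (t : ℕ) (M : RAM.Memory),
        RAM.Exec ((n * k + 2) ^ c) P (RAM.input A) t M ∧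
        t ≤ C * (max k 1 * n * max (Nat.log 2 n) 1) ∧
        RAM.IsOutput M B ∧
        (∃ T : A.CollectingTree, B = (A.collecting T).relabel finSuccEquivLast) ∧
        B.IsComplete ∧
        (B.Synchronizing ↔ A.Synchronizing) := by
  -- The constant `2152 = 800 * 2 + 280 + 90 + 182` comes from the time bound in
  -- `RAM.wp_collectingProg`, where all summands are compared with the product in the statement.
  refine ⟨RAM.collectingProg, 2152, 5, fun n k A hn hA => ?_⟩
  have hW : 4 * (n * k + n + k + 1) < (n * k + 2) ^ 5 := by
    have h1 := hA.card_le
    have h2 : k ≤ n * k := Nat.le_mul_of_pos_left k hn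
    have h3 : 2 ^ 4 ≤ (n * k + 2) ^ 4 := Nat.pow_le_pow_left (by omega) 4
    calc 4 * (n * k + n + k + 1) < 2 ^ 4 * (n * k + 2) := by omega
      _ ≤ (n * k + 2) ^ 4 * (n * k + 2) := Nat.mul_le_mul_right _ h3
      _ = (n * k + 2) ^ 5 := by ring
  have hprog := RAM.wp_collectingProg hW hn A hA
  unfold RAM.WP at hprog
  obtain ⟨t, M, hexec, ht, T, hout⟩ := hprog
  have : Nonempty (Fin n) := ⟨⟨0, hn⟩⟩
  refine ⟨_, t, M, hexec, ?_, hout, ⟨T, rfl⟩, fun q a => A.collecting_isComplete T q _, ?_⟩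
  · have h1 : 1 ≤ max k 1 := le_max_right _ _
    have h2 : 1 ≤ max (Nat.log 2 n) 1 := le_max_right _ _
    have h3 : n ≤ max k 1 * n := Nat.le_mul_of_pos_left n h1
    have h4 : max k 1 * n ≤ max k 1 * n * max (Nat.log 2 n) 1 := Nat.le_mul_of_pos_right _ h2
    have h5 : n * k ≤ max k 1 * n := by
      rw [Nat.mul_comm]
      exact Nat.mul_le_mul_right n (le_max_left _ _)
    have h6 : n * k * (Nat.log 2 n + 1) ≤ max k 1 * n * (2 * max (Nat.log 2 n) 1) := by
      have := le_max_left (Nat.log 2 n) 1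
      exact Nat.mul_le_mul h5 (by omega)
    have h7 : max k 1 * n * (2 * max (Nat.log 2 n) 1) =
        2 * (max k 1 * n * max (Nat.log 2 n) 1) := by ring
    rw [Nat.mul_assoc] at ht
    omega
  · rw [PartialAutomaton.relabel_synchronizing_iff]
    exact A.collecting_synchronizing_iff T hA
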